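/- Let $H$ be an $\mathbb R^d$-valued random vector such that $nP(a_n^{-1}H\in\cdot)\to\mu$ vaguely on $\overline{\mathbb R^d}\setminus\{0\}$ for some sequence $a_n\to\infty$ and some non-null Radon measure $\mu$ on $\overline{\mathbb R^d}\setminus\{0\}$ with $\mu(\overline{\mathbb R^d}\setminus\mathbb R^d)=0$, where $\overline{\mathbb R^d}$ is the compactification of $\mathbb R^d$ by a sphere at infinity. Let $\alpha>0$ be its tail index, i.e. $\mu(cA)=c^{-\alpha}\mu(A)$ for all $c>0$ and all Borel $A\subset\mathbb R^d\setminus\{0\}$, and suppose $\alpha<2$. If $\alpha=1$, assume that $H$ and $-H$ have the same law; if $1<\alpha<2$, assume that $EH=0$. Let $L\ge0$ be a random variable with $Ee^{\varepsilon L}<\infty$ for some $\varepsilon>0$. Let $H_1,H_2,\dots$ be i.i.d. copies of $H$ and $L_1,L_2,\dots$ i.i.d. copies of $L$, the two sequences being independent of each other. Let $M_n\to\infty$ be such that $nP(\|H\|>M_n)\to\infty$ (hard truncation), where $\|\cdot\|$ is the Euclidean norm, and put $$X_{nj}=H_j\mathbf 1(\|H_j\|\le M_n)+\frac{H_j}{\|H_j\|}(M_n+L_j)\mathbf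 1(\|H_j\|>M_n),\qquad S_n=\sum_{j=1}^nX_{nj}.$$ Let $B_1=\{x:\|x\|\le1\}$, $\mathcal S=\{x:\|x\|=1\}$, and for Borel sets $A$ let $$\sigma(A)=\frac{\mu\{x\in\mathbb R^d:\|x\|\ge1,\ x/\|x\|\in A\}}{\mu(B_1^c)},\qquad \nu(A)=\frac{\mu(A\cap B_1)}{\mu(B_1^c)}+\sigma(A\cap\mathcal S).$$ For $\lambda\in\mathbb R^d$ let $$\Lambda(\lambda)=\begin{cases}\int_{\mathbb R^d}(e^{\langle\lambda,x\rangle}-1)\,\nu(dx),&0<\alpha<1,\\ \int_{\mathbb R^d}(e^{\langle\lambda,x\rangle}-1-\langle\lambda,x\rangle)\,\nu(dx),&\alpha=1,\\ \int_{\mathbb R^d}(e^{\langle\lambda,x\rangle}-1-\langle\lambda,x\rangle)\,\nu(dx)-\frac1{\alpha-1}\int_{\mathcal S}\langle\lambda,s\rangle\,\sigma(ds),&1<\alpha<2.\end{cases}$$ Then these integrals converge absolutely, and $Z_n=S_n/\{nM_nP(\|H\|>M_n)\}$ satisfies the large deviation principle with speed $c_n=nP(\|H\|>M_n)$ and rate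 function the Fenchel–Legendre transform $\Lambda^*(x)=\sup_{\lambda\in\mathbb R^d}(\langle\lambda,x\rangle-\Lambda(\lambda))$. That is, $\Lambda^*$ is lower semicontinuous with values in $[0,\infty]$, and for every Borel set $A\subset\mathbb R^d$, $$-\inf_{x\in\operatorname{int}A}\Lambda^*(x)\le\liminf_{n\to\infty}\frac1{c_n}\log P(Z_n\in A)\le\limsup_{n\to\infty}\frac1{c_n}\log P(Z_n\in A)\le-\inf_{x\in\operatorname{cl}A}\Lambda^*(x).$$ -/

import Mathlib

open MeasureTheory ProbabilityTheory Filter Topology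

noncomputable section

namespace TruncatedTails

/-- The Euclidean space `ℝ^d` with the `L²` norm. -/
abbrev E (d : ℕ) : Type := EuclideanSpace ℝ (Fin d)

/-! ### Vague convergence on the punctured compactification of `ℝ^d` -/

/-- The compactification of `ℝ^d` by a sphere at infinity, with the origin removed. It is modelled
by the closed unit ball without `0`: a point `x` of `ℝ^d` is represented by `x / (1 + ‖x‖)`, and
the unit sphere represents the points at infinity. -/
abbrev PuncturedExt (d : ℕ) : Type := {y : E d // ‖y‖ ≤ 1 ∧ y ≠ 0}

/-- The inclusion of `ℝ^d` in its compactification. -/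
def radial {d : ℕ} (x : E d) : E d := (1 + ‖x‖)⁻¹ • x

/-- A measure on `ℝ^d`, restricted to `ℝ^d ∖ {0}` and extended to the punctured compactification
by giving no mass to the points at infinity. -/
def extend {d : ℕ} (m : Measure (E d)) : Measure (PuncturedExt d) :=
  (m.map radial).comap Subtype.val

/-- Vague convergence: convergence of the integrals of continuous compactly supported functions. -/
def VagueTendsto {X : Type*} [TopologicalSpace X] [MeasurableSpace X]
    (ms : ℕ → Measure X) (m : Measure X) : Prop :=
  ∀ f : X → ℝ, Continuous f → HasCompactSupport f →
    Tendsto (fun n => ∫ x, f x ∂(ms n)) atTop (𝓝 (∫ x, f x ∂m))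

/-! ### Power-law tails -/

/-- `n P(H / a_n ∈ ·) → μ` vaguely on the punctured compactification of `ℝ^d`, where `a_n → ∞` and
`μ` is a non-null Radon measure without mass at infinity. A measure on `ℝ^d ∖ {0}` is regarded as a
measure on `ℝ^d` that does not charge `0`; the relatively compact subsets of the punctured
compactification are those bounded away from `0`, so that being Radon means being finite on
`{x | r < ‖x‖}` for every `r > 0`. -/
structure HasPowerLawTail {Ω : Type*} [MeasurableSpace Ω] {d : ℕ} (P : Measure Ω)
    (H : Ω → E d) (a : ℕ → ℝ) (μ : Measure (E d)) : Prop where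
  scale_tendsto : Tendsto a atTop atTop
  not_charge_zero : μ {0} = 0
  non_null : μ ≠ 0
  radon : ∀ r : ℝ, 0 < r → μ {x | r < ‖x‖} < ⊤
  vague : VagueTendsto
    (fun n => extend ((n : ENNReal) • P.map (fun ω => (a n)⁻¹ • H ω))) (extend μ)

/-- `α` is the tail index of `μ`: `μ(cA) = c^{-α} μ(A)` for all `c > 0` and all Borel sets `A`. -/
def IsTailIndex {d : ℕ} (μ : Measure (E d)) (α : ℝ) : Prop :=
  0 < α ∧ ∀ c : ℝ, 0 < c → ∀ A : Set (E d), MeasurableSet A →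
    μ ((fun x => c • x) '' A) = ENNReal.ofReal (c ^ (-α)) * μ A

/-- The spectral measure `σ(A) = μ{x : ‖x‖ ≥ 1, x/‖x‖ ∈ A} / μ(B_1ᶜ)`, as a measure on `ℝ^d`
(carried by the unit sphere), where `B_1` is the closed unit ball. -/
def spectral {d : ℕ} (μ : Measure (E d)) : Measure (E d) :=
  (μ (Metric.closedBall 0 1)ᶜ)⁻¹ • (μ.restrict {x | 1 ≤ ‖x‖}).map (fun x => ‖x‖⁻¹ • x)

/-- The measure `ν(A) = μ(A ∩ B_1) / μ(B_1ᶜ) + σ(A ∩ S)`, where `S` is the unit sphere. -/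
def nu {d : ℕ} (μ : Measure (E d)) : Measure (E d) :=
  (μ (Metric.closedBall 0 1)ᶜ)⁻¹ • μ.restrict (Metric.closedBall 0 1)
    + (spectral μ).restrict (Metric.sphere 0 1)

/-! ### The truncated model -/

/-- The truncation of `h` at level `M`:
`h 1(‖h‖ ≤ M) + (h/‖h‖) (M + l) 1(‖h‖ > M)`. -/
def truncate {d : ℕ} (M : ℝ) (h : E d) (l : ℝ) : E d :=
  if ‖h‖ ≤ M then h else (M + l) • (‖h‖⁻¹ • h)

/-- The row sum `S_n`; the copies of `H` and `L` are numbered from `0`. -/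
def rowSum {Ω : Type*} {d : ℕ} (M : ℕ → ℝ) (Hs : ℕ → Ω → E d) (Ls : ℕ → Ω → ℝ) (n : ℕ) (ω : Ω) :
    E d :=
  ∑ j ∈ Finset.range n, truncate (M n) (Hs j ω) (Ls j ω)

/-! ### Large deviations -/

/-- The large deviation principle with speed `c_n` and rate function `I`: the function `I` is
lower semicontinuous with values in `[0, ∞]`, and
`-inf_{int A} I ≤ liminf c_n⁻¹ log P(Z_n ∈ A) ≤ limsup c_n⁻¹ log P(Z_n ∈ A) ≤ -inf_{cl A} I`
for every Borel set `A`, with `log 0 = -∞` and `inf ∅ = ∞`. -/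
structure IsLDP {Ω : Type*} [MeasurableSpace Ω] {X : Type*} [TopologicalSpace X]
    [MeasurableSpace X] (P : Measure Ω) (Z : ℕ → Ω → X) (c : ℕ → ℝ) (I : X → EReal) : Prop where
  nonneg : ∀ x, 0 ≤ I x
  lsc : LowerSemicontinuous I
  lower : ∀ A : Set X, MeasurableSet A →
    -(⨅ x ∈ interior A, I x) ≤
      liminf (fun n => (((c n)⁻¹ : ℝ) : EReal) * ENNReal.log (P {ω | Z n ω ∈ A})) atTop
  upper : ∀ A : Set X, MeasurableSet A →
    limsup (fun n => (((c n)⁻¹ : ℝ) : EReal) * ENNReal.log (P {ω | Z n ω ∈ A})) atTop ≤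
      -(⨅ x ∈ closure A, I x)

/-- The Fenchel–Legendre transform `Λ*(x) = sup_l (⟨l, x⟩ - Λ(l))`. -/
def fenchelLegendre {d : ℕ} (Λ : E d → ℝ) (x : E d) : EReal :=
  ⨆ l : E d, ((inner ℝ l x - Λ l : ℝ) : EReal)

/-- The integrand of the `ν`-integral in `Λ`: `e^{⟨l,x⟩} - 1` for `α < 1`, and
`e^{⟨l,x⟩} - 1 - ⟨l,x⟩` for `α ≥ 1`. -/
def integrand {d : ℕ} (α : ℝ) (l x : E d) : ℝ :=
  if α < 1 then Real.exp (inner ℝ l x) - 1 else Real.exp (inner ℝ l x) - 1 - inner ℝ l x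

/-- The function `Λ`, for `0 < α < 2`. -/
def Lam {d : ℕ} (μ : Measure (E d)) (α : ℝ) (l : E d) : ℝ :=
  if α ≤ 1 then ∫ x, integrand α l x ∂(nu μ)
  else (∫ x, integrand α l x ∂(nu μ)) - 1 / (α - 1) * ∫ s, inner ℝ l s ∂(spectral μ)

end TruncatedTails

end

/-!
By the Gärtner–Ellis theorem it suffices that the scaled cumulant generating functions of `Z_n`
converge to a differentiable `Λ`. By independence, these are
`log (E exp (⟨l, X_{n1}⟩ / M_n)) / P(‖H‖ > M_n)`, so the point is to show that
`(E exp (⟨l, X⟩ / t) - 1) / P(‖H‖ > t) → Λ(l)` as `t → ∞`, where `X` is the vector truncated at `t`.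

Up to the overshoot `L / t`, which is negligible because `L` has exponential moments, `X / t` is the
retraction of `H / t` onto the unit ball. Compensated exponentials are radial primitives
`∫₀^{‖x‖} ψ(s, x / ‖x‖) ds`, so that their expectations are integrals over `s` of the tail
integrals of `H` at the levels `t s`. Divided by `P(‖H‖ > t)`, these converge by regular variation,
and Potter's bound dominates them near `s = 0`, where `|ψ(s, u)|` is of order `1` or `s` according
to the order of the compensation. For `α ≥ 1` the compensator contributes the mean of the
retracted vector, which is zero by symmetry when `α = 1`; when `α > 1` it is minus the mean of the
part cut off, which produces the spectral term in `Λ`.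
-/

namespace TruncatedTails

open scoped RealInnerProductSpace

/-! ### The Gärtner–Ellis theorem -/

section GartnerEllis

variable {V : Type*} [NormedAddCommGroup V] [InnerProductSpace ℝ V]

lemma exists_finset_compl_ball_subset [FiniteDimensional ℝ V] : ∃ S : Finset V, ∀ (y : V) (r : ℝ),
    0 < r → (Metric.ball y r)ᶜ ⊆ ⋃ v ∈ S, {x | ⟪v, y⟫ + r ≤ ⟪v, x⟫} := by
  have hnhds : ∀ u ∈ Metric.sphere (0 : V) 1, {x | 1 < ⟪(2 : ℝ) • u, x⟫} ∈ 𝓝 u := by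
    intro u hu
    refine (isOpen_lt continuous_const (by fun_prop)).mem_nhds ?_
    simp [real_inner_smul_left, mem_sphere_zero_iff_norm.1 hu]
  classical
  obtain ⟨T, -, hT⟩ := (isCompact_sphere (0 : V) 1).elim_nhds_subcover _ hnhds
  refine ⟨T.image fun u => (2 : ℝ) • u, fun y r hr x hx => ?_⟩
  have hdist : r ≤ ‖x - y‖ := by simpa [dist_eq_norm] using hx
  have hpos : 0 < ‖x - y‖ := hr.trans_le hdist
  have hunit : ‖x - y‖⁻¹ • (x - y) ∈ Metric.sphere (0 : V) 1 := by simp [norm_smul, hpos.ne']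
  obtain ⟨u, huT, hu⟩ := Set.mem_iUnion₂.1 (hT hunit)
  refine Set.mem_iUnion₂.2 ⟨(2 : ℝ) • u, Finset.mem_image_of_mem _ huT, ?_⟩
  have hu' : ‖x - y‖ < ⟪(2 : ℝ) • u, x⟫ - ⟪(2 : ℝ) • u, y⟫ := by
    simpa [real_inner_smul_right, lt_inv_mul_iff₀ hpos, inner_sub_right] using hu
  have : ⟪(2 : ℝ) • u, y⟫ + r ≤ ⟪(2 : ℝ) • u, x⟫ := by linarith
  exact this

lemma exists_gradient_eq_sub_smul [FiniteDimensional ℝ V] {Λ : V → ℝ} (hΛ : Differentiable ℝ Λ)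
    {y : V} {K ε : ℝ} (hK : ∀ l, ⟪l, y⟫ - Λ l ≤ K) (hε : 0 < ε) :
    ∃ l, HasGradientAt Λ (y - ε • l) l ∧ Λ l - ⟪l, y⟫ + ε / 2 * ‖l‖ ^ 2 ≤ Λ 0 := by
  set f : V → ℝ := fun l => Λ l - ⟪y, l⟫ + ε / 2 * ‖l‖ ^ 2 with hf
  have hcoercive : Tendsto f (cocompact V) atTop := by
    have hquad : Tendsto (fun l : V => -K + ε / 2 * ‖l‖ ^ 2) (cocompact V) atTop :=
      tendsto_atTop_add_const_left _ _ (((tendsto_pow_atTop two_ne_zero).comp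
        tendsto_norm_cocompact_atTop).const_mul_atTop (half_pos hε))
    refine tendsto_atTop_mono (fun l => ?_) hquad
    have := hK l
    rw [real_inner_comm] at this
    simp only [hf]
    linarith
  have hcont : Continuous f := by
    have := hΛ.continuous
    fun_prop
  obtain ⟨l, hl⟩ := hcont.exists_forall_le hcoercive
  refine ⟨l, ?_, by simpa [hf, real_inner_comm] using hl 0⟩
  have hderiv : HasFDerivAt f (fderiv ℝ Λ l - innerSL ℝ y + (ε / 2) • (2 • innerSL ℝ l)) l :=
    (((hΛ l).hasFDerivAt.sub (innerSL ℝ y).hasFDerivAt).add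
      ((hasStrictFDerivAt_norm_sq l).hasFDerivAt.const_mul (ε / 2)))
  have hcrit := IsLocalMin.hasFDerivAt_eq_zero (Eventually.of_forall hl) hderiv
  have hfderiv : fderiv ℝ Λ l = InnerProductSpace.toDual ℝ V (y - ε • l) := by
    ext v
    have := DFunLike.congr_fun hcrit v
    simp at this ⊢
    linarith
  rw [hasGradientAt_iff_hasFDerivAt, ← hfderiv]
  exact (hΛ l).hasFDerivAt

lemma exists_hasGradientAt_near [FiniteDimensional ℝ V] {Λ : V → ℝ} (hΛ : Differentiable ℝ Λ)
    (h0 : Λ 0 = 0) {y : V} {K δ : ℝ} (hK : ∀ l, ⟪l, y⟫ - Λ l ≤ K) (hδ : 0 < δ) :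
    ∃ l z, HasGradientAt Λ z l ∧ ‖z - y‖ < δ ∧ ⟪l, z⟫ - Λ l ≤ K := by
  have hK0 : 0 ≤ K := by simpa [h0] using hK 0
  set ε := δ ^ 2 / (2 * K + 1) / 2 with hε
  have hε0 : 0 < ε := by positivity
  obtain ⟨l, hgrad, hmin⟩ := exists_gradient_eq_sub_smul hΛ hK hε0
  refine ⟨l, y - ε • l, hgrad, ?_, ?_⟩
  · have hbound : ε / 2 * ‖l‖ ^ 2 ≤ K := by linarith [hK l]
    rw [sub_sub_cancel_left, norm_neg, norm_smul, Real.norm_of_nonneg hε0.le]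
    refine lt_of_pow_lt_pow_left₀ 2 hδ.le ?_
    calc (ε * ‖l‖) ^ 2 = 2 * ε * (ε / 2 * ‖l‖ ^ 2) := by ring
      _ ≤ 2 * ε * K := by gcongr
      _ = δ ^ 2 * (K / (2 * K + 1)) := by rw [hε]; field_simp
      _ < δ ^ 2 := mul_lt_of_lt_one_right (by positivity)
        ((div_lt_one (by positivity)).2 (by linarith))
  · rw [inner_sub_right, real_inner_smul_right]
    have := mul_nonneg hε0.le (real_inner_self_nonneg (x := l))
    linarith [hK l]

variable [MeasurableSpace V]

/-- The cumulant generating functions of the laws `ρ n`, evaluated at `c n • l` and divided by the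
speed `c n`, are eventually finite and converge to `Λ l`. -/
structure HasScaledCGF (ρ : ℕ → Measure V) (c : ℕ → ℝ) (Λ : V → ℝ) : Prop where
  speed : Tendsto c atTop atTop
  integrable : ∀ l, ∀ᶠ n in atTop, Integrable (fun x => Real.exp (c n * ⟪l, x⟫)) (ρ n)
  tendsto : ∀ l, Tendsto (fun n => (c n)⁻¹ * cgf (fun x => ⟪l, x⟫) (ρ n) (c n)) atTop (𝓝 (Λ l))

namespace HasScaledCGF

variable {ρ : ℕ → Measure V} {c : ℕ → ℝ} {Λ : V → ℝ}

lemma map_zero [∀ n, IsProbabilityMeasure (ρ n)] (h : HasScaledCGF ρ c Λ) : Λ 0 = 0 :=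
  tendsto_nhds_unique (h.tendsto 0) (by simp [cgf, mgf])

lemma isBigO_halfSpace [∀ n, IsFiniteMeasure (ρ n)] (h : HasScaledCGF ρ c Λ) (l : V) {s b : ℝ}
    (hb : b < s - Λ l) :
    (fun n => (ρ n).real {x | s ≤ ⟪l, x⟫}) =O[atTop] fun n => Real.exp (-(c n * b)) := by
  refine Asymptotics.IsBigO.of_bound 1 ?_
  filter_upwards [h.integrable l, (h.tendsto l).eventually_lt_const (lt_sub_comm.1 hb),
    h.speed.eventually_gt_atTop 0] with n hint hcgf hc
  rw [one_mul, Real.norm_of_nonneg measureReal_nonneg, Real.norm_of_nonneg (Real.exp_pos _).le]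
  refine (measure_ge_le_exp_cgf s hc.le hint).trans (Real.exp_le_exp.2 ?_)
  rw [inv_mul_lt_iff₀ hc] at hcgf
  linarith

end HasScaledCGF

section MeasureDecay

variable {X : Type*} [MeasurableSpace X] {ρ : ℕ → Measure X} {g : ℕ → ℝ} {A B : Set X}

lemma isBigO_measureReal_mono [∀ n, IsFiniteMeasure (ρ n)]
    (hB : (fun n => (ρ n).real B) =O[atTop] g) (hAB : A ⊆ B) :
    (fun n => (ρ n).real A) =O[atTop] g := by
  refine (Asymptotics.IsBigO.of_norm_le fun n => ?_).trans hB
  rw [Real.norm_of_nonneg measureReal_nonneg]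
  exact measureReal_mono hAB

lemma isBigO_measureReal_union (hA : (fun n => (ρ n).real A) =O[atTop] g)
    (hB : (fun n => (ρ n).real B) =O[atTop] g) : (fun n => (ρ n).real (A ∪ B)) =O[atTop] g := by
  refine (Asymptotics.IsBigO.of_norm_le fun n => ?_).trans (hA.add hB)
  rw [Real.norm_of_nonneg measureReal_nonneg]
  exact measureReal_union_le A B

lemma isBigO_measureReal_biUnion {ι : Type*} {T : Finset ι} {U : ι → Set X}
    (hU : ∀ i ∈ T, (fun n => (ρ n).real (U i)) =O[atTop] g) :
    (fun n => (ρ n).real (⋃ i ∈ T, U i)) =O[atTop] g := by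
  refine (Asymptotics.IsBigO.of_norm_le fun n => ?_).trans (Asymptotics.IsBigO.fun_sum hU)
  rw [Real.norm_of_nonneg measureReal_nonneg]
  exact measureReal_biUnion_finset_le T U

end MeasureDecay

variable {ρ : ℕ → Measure V} {c : ℕ → ℝ} {Λ : V → ℝ}

namespace HasScaledCGF

lemma exponentially_tight [FiniteDimensional ℝ V] [∀ n, IsFiniteMeasure (ρ n)]
    (h : HasScaledCGF ρ c Λ) (b : ℝ) :
    ∃ r, (fun n => (ρ n).real (Metric.ball 0 r)ᶜ) =O[atTop] fun n => Real.exp (-(c n * b)) := by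
  obtain ⟨S, hS⟩ := exists_finset_compl_ball_subset (V := V)
  obtain ⟨K, hK⟩ : BddAbove (Λ '' S) := (S.finite_toSet.image Λ).bddAbove
  refine ⟨max 1 (K + b + 1), isBigO_measureReal_mono (isBigO_measureReal_biUnion fun v hv => ?_)
    (hS 0 _ (zero_lt_one.trans_le (le_max_left _ _)))⟩
  have hv' := hK (Set.mem_image_of_mem Λ hv)
  refine h.isBigO_halfSpace v ?_
  rw [inner_zero_right, zero_add]
  linarith [le_max_right 1 (K + b + 1)]

theorem isBigO_of_isClosed [FiniteDimensional ℝ V] [∀ n, IsFiniteMeasure (ρ n)]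
    (h : HasScaledCGF ρ c Λ) {F : Set V} (hF : IsClosed F) {b : ℝ}
    (hb : ∀ x ∈ F, ∃ l, b < ⟪l, x⟫ - Λ l) :
    (fun n => (ρ n).real F) =O[atTop] fun n => Real.exp (-(c n * b)) := by
  obtain ⟨r, hr⟩ := h.exponentially_tight b
  have hcompact : IsCompact (F ∩ Metric.closedBall 0 r) := (isCompact_closedBall 0 r).inter_left hF
  have hball : (fun n => (ρ n).real (F ∩ Metric.closedBall 0 r)) =O[atTop]
      fun n => Real.exp (-(c n * b)) := by
    refine hcompact.induction_on (by simpa using Asymptotics.isBigO_zero _ _)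
      (fun s t hst ht => isBigO_measureReal_mono ht hst)
      (fun s t hs ht => isBigO_measureReal_union hs ht) fun x hx => ?_
    obtain ⟨l, hl⟩ := hb x hx.1
    obtain ⟨s, hbs, hsx⟩ := exists_between hl
    refine ⟨{z | s + Λ l ≤ ⟪l, z⟫}, mem_nhdsWithin_of_mem_nhds ?_,
      h.isBigO_halfSpace l (by linarith)⟩
    exact (continuous_const.inner continuous_id).tendsto x |>.eventually_const_le
      (lt_sub_iff_add_lt.1 hsx)
  refine isBigO_measureReal_mono (isBigO_measureReal_union hball hr) fun x hx => ?_
  by_cases hxr : x ∈ Metric.closedBall 0 r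
  · exact Or.inl ⟨hx, hxr⟩
  · exact Or.inr fun hx' => hxr (Metric.ball_subset_closedBall hx')

lemma tendsto_measureReal_compl_ball [FiniteDimensional ℝ V] [∀ n, IsFiniteMeasure (ρ n)]
    (h : HasScaledCGF ρ c Λ) (h0 : Λ 0 = 0) {y : V} (hy : HasGradientAt Λ y 0) {r : ℝ}
    (hr : 0 < r) :
    Tendsto (fun n => (ρ n).real (Metric.ball y r)ᶜ) atTop (𝓝 0) := by
  obtain ⟨S, hS⟩ := exists_finset_compl_ball_subset (V := V)
  have hhalf : ∀ v, Tendsto (fun n => (ρ n).real {x | ⟪v, y⟫ + r ≤ ⟪v, x⟫}) atTop (𝓝 0) := by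
    intro v
    obtain ⟨t, hslope, ht⟩ : ∃ t : ℝ, t⁻¹ • Λ (t • v) < ⟪v, y⟫ + r ∧ 0 < t := by
      have hlim := (hy.hasFDerivAt.hasLineDerivAt v).tendsto_slope_zero_right
      simp only [zero_add, h0, sub_zero, InnerProductSpace.toDual_apply_apply,
        real_inner_comm v y] at hlim
      exact ((hlim.eventually_lt_const (by linarith)).and self_mem_nhdsWithin).exists
    rw [smul_eq_mul, inv_mul_lt_iff₀ ht] at hslope
    obtain ⟨b, hb, hbt⟩ := exists_between (sub_pos.2 hslope)
    have hdecay := h.isBigO_halfSpace (t • v) hbt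
    simp only [real_inner_smul_left, mul_le_mul_iff_right₀ ht] at hdecay
    exact hdecay.trans_tendsto
      (Real.tendsto_exp_neg_atTop_nhds_zero.comp (h.speed.atTop_mul_const hb))
  refine squeeze_zero (fun n => measureReal_nonneg) (fun n => ?_)
    (by simpa using tendsto_finsetSum S fun v _ => hhalf v)
  exact (measureReal_mono (hS y r hr) (measure_ne_top _ _)).trans
    (measureReal_biUnion_finset_le _ _)

lemma tilted [∀ n, IsProbabilityMeasure (ρ n)] (h : HasScaledCGF ρ c Λ) (l : V) :
    HasScaledCGF (fun n => (ρ n).tilted fun x => c n * ⟪l, x⟫) c fun v => Λ (l + v) - Λ l where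
  speed := h.speed
  integrable v := by
    filter_upwards [h.integrable l, h.integrable (l + v)] with n hl hlv
    rw [integrable_tilted_iff hl]
    simpa only [smul_eq_mul, ← Real.exp_add, ← mul_add, ← inner_add_left] using hlv
  tendsto v := by
    refine ((h.tendsto (l + v)).sub (h.tendsto l)).congr' ?_
    filter_upwards [h.integrable l, h.integrable (l + v)] with n hl hlv
    rw [← mul_sub, cgf, cgf, cgf, ← Real.log_div (mgf_pos hlv).ne' (mgf_pos hl).ne']
    simp only [mgf, integral_exp_tilted, Pi.add_apply, ← mul_add, ← inner_add_left]

end HasScaledCGF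

lemma measureReal_tilted_le_of_forall_mem_le {X : Type*} [MeasurableSpace X] (m : Measure X)
    [IsFiniteMeasure m] (f : X → ℝ) {s : Set X} {K : ℝ} (hK : ∀ x ∈ s, f x ≤ K) :
    (m.tilted f).real s ≤ Real.exp K / (∫ x, Real.exp (f x) ∂m) * m.real s := by
  have : 0 ≤ ∫ x, Real.exp (f x) ∂m := integral_nonneg fun x => (Real.exp_pos _).le
  calc (m.tilted f).real s = ∫ x in s, Real.exp (f x) / (∫ x, Real.exp (f x) ∂m) ∂m := by
        simpa using setIntegral_tilted (μ := m) f (fun _ => (1 : ℝ)) s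
    _ ≤ Real.exp K / (∫ x, Real.exp (f x) ∂m) * m.real s := by
        refine (Real.le_norm_self _).trans
          (norm_setIntegral_le_of_norm_le_const (measure_lt_top _ _) fun x hx => ?_)
        rw [Real.norm_of_nonneg (by positivity)]
        gcongr
        exact hK x hx

lemma HasScaledCGF.exp_le_measureReal_ball [FiniteDimensional ℝ V] [OpensMeasurableSpace V]
    [∀ n, IsProbabilityMeasure (ρ n)] (h : HasScaledCGF ρ c Λ) {l y : V}
    (hy : HasGradientAt Λ y l) {r b : ℝ} (hr : 0 < r) (hb : ⟪l, y⟫ - Λ l + ‖l‖ * r < b) :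
    ∀ᶠ n in atTop, Real.exp (-(c n * b)) ≤ (ρ n).real (Metric.ball y r) := by
  obtain ⟨b', hb', hbb'⟩ := exists_between hb
  have hgrad : HasGradientAt (fun v => Λ (l + v) - Λ l) y 0 := by
    have hy0 : HasFDerivAt Λ (InnerProductSpace.toDual ℝ V y) (l + 0) := by
      simpa using hy.hasFDerivAt
    exact ((hasFDerivAt_comp_add_left l).2 hy0).sub_const (Λ l)
  have hconc := (h.tilted l).tendsto_measureReal_compl_ball (by simp) hgrad hr
  filter_upwards [hconc.eventually_lt_const one_half_pos, h.integrable l,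
    (h.tendsto l).eventually_const_lt (show ⟪l, y⟫ + ‖l‖ * r - b' < Λ l by linarith),
    h.speed.eventually_gt_atTop 0, (h.speed.atTop_mul_const (sub_pos.2 hbb')).eventually_ge_atTop
      (Real.log 2)] with n hout hint hcgf hc hlog
  have := isProbabilityMeasure_tilted hint
  rw [probReal_compl_eq_one_sub Metric.isOpen_ball.measurableSet] at hout
  have hball : ∀ x ∈ Metric.ball y r, c n * ⟪l, x⟫ ≤ c n * (⟪l, y⟫ + ‖l‖ * r) := by
    intro x hx
    have hxy : ⟪l, x - y⟫ ≤ ‖l‖ * r := (real_inner_le_norm _ _).trans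
      (mul_le_mul_of_nonneg_left (mem_ball_iff_norm.1 hx).le (norm_nonneg _))
    rw [inner_sub_right] at hxy
    gcongr
    linarith
  have htilt := measureReal_tilted_le_of_forall_mem_le (ρ n) _ hball
  have hmgf := exp_cgf hint
  rw [mgf] at hmgf
  rw [← hmgf, ← Real.exp_sub] at htilt
  rw [lt_inv_mul_iff₀ hc] at hcgf
  calc Real.exp (-(c n * b)) ≤ Real.exp (-(c n * b') - Real.log 2) :=
        Real.exp_le_exp.2 (by linarith)
    _ = Real.exp (-(c n * b')) * (1 / 2) := by
        rw [Real.exp_sub, Real.exp_log two_pos, div_eq_mul_one_div]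
    _ ≤ Real.exp (-(c n * b')) * (Real.exp (c n * b') * (ρ n).real (Metric.ball y r)) := by
        gcongr
        refine (by linarith : (1 : ℝ) / 2 ≤ _).trans (htilt.trans ?_)
        gcongr
        linarith
    _ = (ρ n).real (Metric.ball y r) := by
        rw [← mul_assoc, ← Real.exp_add, neg_add_cancel, Real.exp_zero, one_mul]

lemma coe_le_inv_mul_log_measure {X : Type*} [MeasurableSpace X] {m : Measure X} {s : Set X}
    {b c : ℝ} (hc : 0 < c) (h : Real.exp (c * b) ≤ m.real s) :
    (b : EReal) ≤ ((c⁻¹ : ℝ) : EReal) * ENNReal.log (m s) := by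
  have hlog : ((c * b : ℝ) : EReal) ≤ ENNReal.log (m s) := by
    rw [← Real.log_exp (c * b), ← ENNReal.log_ofReal_of_pos (Real.exp_pos _)]
    exact ENNReal.log_monotone (ENNReal.ofReal_le_of_le_toReal h)
  calc (b : EReal) = ((c⁻¹ : ℝ) : EReal) * ((c * b : ℝ) : EReal) := by
        rw [← EReal.coe_mul, inv_mul_cancel_left₀ hc.ne']
    _ ≤ _ := mul_le_mul_of_nonneg_left hlog (EReal.coe_nonneg.2 (inv_nonneg.2 hc.le))

lemma inv_mul_log_measure_le_coe {X : Type*} [MeasurableSpace X] {m : Measure X}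
    [IsFiniteMeasure m] {s : Set X} {b c : ℝ} (hc : 0 < c) (h : m.real s ≤ Real.exp (c * b)) :
    ((c⁻¹ : ℝ) : EReal) * ENNReal.log (m s) ≤ b := by
  have hlog : ENNReal.log (m s) ≤ ((c * b : ℝ) : EReal) := by
    rw [← Real.log_exp (c * b), ← ENNReal.log_ofReal_of_pos (Real.exp_pos _),
      ← ofReal_measureReal]
    exact ENNReal.log_monotone (ENNReal.ofReal_le_ofReal h)
  calc _ ≤ ((c⁻¹ : ℝ) : EReal) * ((c * b : ℝ) : EReal) :=
        mul_le_mul_of_nonneg_left hlog (EReal.coe_nonneg.2 (inv_nonneg.2 hc.le))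
    _ = b := by rw [← EReal.coe_mul, inv_mul_cancel_left₀ hc.ne']

end GartnerEllis

section LDP

variable {d : ℕ} {Λ : E d → ℝ}

lemma fenchelLegendre_nonneg (h0 : Λ 0 = 0) (x : E d) : 0 ≤ fenchelLegendre Λ x :=
  le_trans (by simp [h0]) (le_iSup (fun l : E d => ((⟪l, x⟫ - Λ l : ℝ) : EReal)) 0)

lemma lowerSemicontinuous_fenchelLegendre (Λ : E d → ℝ) :
    LowerSemicontinuous (fenchelLegendre Λ) :=
  lowerSemicontinuous_iSup fun _ => Continuous.lowerSemicontinuous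
    (continuous_coe_real_ereal.comp (by fun_prop))

lemma lt_fenchelLegendre_iff {x : E d} {b : ℝ} :
    b < fenchelLegendre Λ x ↔ ∃ l, b < ⟪l, x⟫ - Λ l := by
  simp only [fenchelLegendre, lt_iSup_iff, EReal.coe_lt_coe_iff]

namespace HasScaledCGF

variable {ρ : ℕ → Measure (E d)} [∀ n, IsProbabilityMeasure (ρ n)] {c : ℕ → ℝ}

lemma limsup_le_neg_iInf (h : HasScaledCGF ρ c Λ) (A : Set (E d)) :
    limsup (fun n => (((c n)⁻¹ : ℝ) : EReal) * ENNReal.log (ρ n A)) atTop ≤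
      -(⨅ x ∈ closure A, fenchelLegendre Λ x) := by
  rw [EReal.le_neg, ← EReal.ge_of_forall_gt_iff_ge]
  intro b hb
  rw [EReal.le_neg, ← EReal.coe_neg, ← EReal.le_of_forall_lt_iff_le]
  intro b' hb'
  obtain ⟨N, hN, hdecay⟩ := (h.isBigO_of_isClosed isClosed_closure (b := b) fun x hx =>
    lt_fenchelLegendre_iff.1 (hb.trans_le (iInf₂_le x hx))).exists_pos
  have hgap : 0 < b' + b := by linarith [EReal.coe_lt_coe_iff.1 hb']
  refine limsup_le_of_le (by isBoundedDefault) ?_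
  filter_upwards [hdecay.bound, h.speed.eventually_gt_atTop 0,
    (h.speed.atTop_mul_const hgap).eventually_ge_atTop (Real.log N)] with n hn hc hlog
  refine inv_mul_log_measure_le_coe hc ((measureReal_mono subset_closure).trans ?_)
  rw [Real.norm_of_nonneg measureReal_nonneg, Real.norm_of_nonneg (Real.exp_pos _).le] at hn
  calc _ ≤ N * Real.exp (-(c n * b)) := hn
    _ = Real.exp (Real.log N + -(c n * b)) := by rw [Real.exp_add, Real.exp_log hN]
    _ ≤ Real.exp (c n * b') := Real.exp_le_exp.2 (by linarith)

lemma neg_iInf_le_liminf (h : HasScaledCGF ρ c Λ) (hΛ : Differentiable ℝ Λ) (A : Set (E d)) :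
    -(⨅ x ∈ interior A, fenchelLegendre Λ x) ≤
      liminf (fun n => (((c n)⁻¹ : ℝ) : EReal) * ENNReal.log (ρ n A)) atTop := by
  rw [EReal.neg_le]
  refine le_iInf₂ fun y hy => ?_
  rw [← EReal.le_of_forall_lt_iff_le]
  intro b hb
  obtain ⟨K, hyK, hKb⟩ := EReal.lt_iff_exists_real_btwn.1 hb
  rw [EReal.coe_lt_coe_iff] at hKb
  obtain ⟨r, hr, hrA⟩ := Metric.isOpen_iff.1 isOpen_interior y hy
  obtain ⟨l, z, hgrad, hzy, hlz⟩ := exists_hasGradientAt_near hΛ h.map_zero (y := y) (K := K)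
    (fun l => not_lt.1 fun hl => hyK.not_gt (lt_fenchelLegendre_iff.2 ⟨l, hl⟩)) (half_pos hr)
  obtain ⟨δ, hδ, hδr, hδb⟩ : ∃ δ > 0, δ < r / 2 ∧ ⟪l, z⟫ - Λ l + ‖l‖ * δ < b := by
    have hlim : Tendsto (fun δ => ⟪l, z⟫ - Λ l + ‖l‖ * δ) (𝓝[>] 0) (𝓝 (⟪l, z⟫ - Λ l)) := by
      refine tendsto_nhdsWithin_of_tendsto_nhds (Continuous.tendsto' (by fun_prop) _ _ (by simp))
    exact ((eventually_mem_nhdsWithin).and ((eventually_nhdsWithin_of_eventually_nhds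
      (eventually_lt_nhds (half_pos hr))).and (hlim.eventually_lt_const (by linarith)))).exists
  have hsub : Metric.ball z δ ⊆ A := fun x hx => interior_subset <| hrA <| by
    have hxz : dist x z < r / 2 := (Metric.mem_ball.1 hx).trans hδr
    have := dist_triangle x z y
    rw [dist_eq_norm z y] at this
    exact Metric.mem_ball.2 (by linarith)
  rw [EReal.neg_le, ← EReal.coe_neg]
  refine le_liminf_of_le (by isBoundedDefault) ?_
  filter_upwards [h.exp_le_measureReal_ball hgrad hδ hδb, h.speed.eventually_gt_atTop 0]
    with n hn hc
  refine coe_le_inv_mul_log_measure hc ?_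
  rw [mul_neg]
  exact hn.trans (measureReal_mono hsub)

end HasScaledCGF

theorem isLDP_of_hasScaledCGF {Ω : Type*} [MeasurableSpace Ω] {P : Measure Ω}
    [IsProbabilityMeasure P] {Z : ℕ → Ω → E d} (hZ : ∀ n, Measurable (Z n)) {c : ℕ → ℝ}
    (h : HasScaledCGF (fun n => P.map (Z n)) c Λ) (hΛ : Differentiable ℝ Λ) :
    IsLDP P Z c (fenchelLegendre Λ) := by
  have (n : ℕ) : IsProbabilityMeasure (P.map (Z n)) :=
    Measure.isProbabilityMeasure_map (hZ n).aemeasurable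
  have hlaw {A : Set (E d)} (hA : MeasurableSet A) (n : ℕ) : P.map (Z n) A = P {ω | Z n ω ∈ A} :=
    Measure.map_apply (hZ n) hA
  refine ⟨fenchelLegendre_nonneg h.map_zero, lowerSemicontinuous_fenchelLegendre Λ,
    fun A hA => ?_, fun A hA => ?_⟩
  · simpa only [hlaw hA] using h.neg_iInf_le_liminf hΛ A
  · simpa only [hlaw hA] using h.limsup_le_neg_iInf A

end LDP

/-! ### Regular variation of the tails -/

section TailIntegral

variable {V : Type*} [NormedAddCommGroup V]

lemma measurableSet_lt_norm [MeasurableSpace V] [OpensMeasurableSpace V] (r : ℝ) :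
    MeasurableSet {x : V | r < ‖x‖} :=
  measurableSet_lt measurable_const measurable_norm

lemma iUnion_singleton_zero_union_lt_norm :
    ⋃ n : ℕ, ({0} ∪ {x : V | 1 / ((n : ℝ) + 1) < ‖x‖}) = Set.univ := by
  refine Set.iUnion_eq_univ_iff.2 fun x => ?_
  rcases eq_or_ne x 0 with hx | hx
  · exact ⟨0, Or.inl hx⟩
  · exact (exists_nat_one_div_lt (norm_pos_iff.2 hx)).imp fun _ => Or.inr

lemma antitone_measureReal_lt_norm [MeasurableSpace V] {m : Measure V}
    [IsFiniteMeasure m] : Antitone fun t => m.real {x | t < ‖x‖} :=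
  fun _ _ hst => measureReal_mono fun _ hx => lt_of_le_of_lt hst hx

variable [NormedSpace ℝ V]

lemma norm_direction {x : V} {r : ℝ} (hr : 0 ≤ r) (hx : r < ‖x‖) : ‖‖x‖⁻¹ • x‖ = 1 :=
  norm_smul_inv_norm (𝕜 := ℝ) (norm_pos_iff.1 (hr.trans_lt hx))

lemma direction_smul {t : ℝ} (ht : 0 < t) (x : V) : ‖t • x‖⁻¹ • (t • x) = ‖x‖⁻¹ • x := by
  rw [norm_smul, Real.norm_of_nonneg ht.le, smul_smul, mul_inv]
  congr 1
  field_simp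

variable [MeasurableSpace V]

/-- The integral of a function of the direction `x / ‖x‖` over the tail `{x | r < ‖x‖}`. -/
noncomputable def tailIntegral (m : Measure V) (φ : V → ℝ) (r : ℝ) : ℝ :=
  ∫ x in {x | r < ‖x‖}, φ (‖x‖⁻¹ • x) ∂m

variable {m : Measure V} {φ ψ : V → ℝ} {r : ℝ}

lemma tailIntegral_one : tailIntegral m (fun _ => 1) r = m.real {x | r < ‖x‖} := by
  simp [tailIntegral]

lemma tailIntegral_nonneg (hφ : 0 ≤ φ) : 0 ≤ tailIntegral m φ r :=
  integral_nonneg fun x => hφ (‖x‖⁻¹ • x)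

lemma abs_tailIntegral_le (hm : m {x | r < ‖x‖} < ⊤) (hr : 0 ≤ r) {K : ℝ}
    (hK : ∀ u, ‖u‖ = 1 → |φ u| ≤ K) : |tailIntegral m φ r| ≤ K * m.real {x | r < ‖x‖} :=
  norm_setIntegral_le_of_norm_le_const (f := fun x => φ (‖x‖⁻¹ • x)) hm
    fun _ hx => hK _ (norm_direction hr hx)

variable [BorelSpace V]

variable [ProperSpace V]

lemma integrableOn_direction (hm : m {x | r < ‖x‖} < ⊤) (hφ : Continuous φ) (hr : 0 ≤ r) :
    IntegrableOn (fun x => φ (‖x‖⁻¹ • x)) {x | r < ‖x‖} m := by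
  obtain ⟨K, hK⟩ := (isCompact_sphere (0 : V) 1).exists_bound_of_continuousOn hφ.continuousOn
  have hmeas : Measurable fun x : V => φ (‖x‖⁻¹ • x) := by fun_prop
  refine IntegrableOn.of_bound hm hmeas.aestronglyMeasurable K ?_
  filter_upwards [ae_restrict_mem (measurableSet_lt_norm r)] with x hx
  exact hK _ (by simpa using norm_direction hr hx)

lemma tailIntegral_sub (hm : m {x | r < ‖x‖} < ⊤) (hφ : Continuous φ) (hψ : Continuous ψ)
    (hr : 0 ≤ r) :
    tailIntegral m (fun x => φ x - ψ x) r = tailIntegral m φ r - tailIntegral m ψ r :=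
  integral_sub (integrableOn_direction hm hφ hr) (integrableOn_direction hm hψ hr)

lemma antitoneOn_tailIntegral [IsFiniteMeasure m] (hφ : Continuous φ) (hφ0 : 0 ≤ φ) :
    AntitoneOn (tailIntegral m φ) (Set.Ici 0) := fun _ hr _ _ hrs =>
  setIntegral_mono_set (integrableOn_direction (measure_lt_top _ _) hφ hr)
    (Eventually.of_forall fun x => hφ0 (‖x‖⁻¹ • x))
    (Eventually.of_forall fun _ hx => lt_of_le_of_lt hrs hx)

lemma tailIntegral_map_smul {t : ℝ} (ht : 0 < t) (hφ : Continuous φ) :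
    tailIntegral (m.map fun x => t⁻¹ • x) φ r = tailIntegral m φ (t * r) := by
  have hφm : Measurable fun x : V => φ (‖x‖⁻¹ • x) := by fun_prop
  rw [tailIntegral, setIntegral_map (measurableSet_lt_norm r) hφm.aestronglyMeasurable
    (by fun_prop)]
  simp only [direction_smul (inv_pos.2 ht), tailIntegral]
  congr 2
  ext x
  simp only [Set.mem_preimage, Set.mem_ofPred_eq, norm_smul, norm_inv, Real.norm_of_nonneg ht.le]
  rw [lt_inv_mul_iff₀ ht]

end TailIntegral

section TailIndex

variable {d : ℕ} {μ : Measure (E d)} {α : ℝ}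

lemma IsTailIndex.map_smul (h : IsTailIndex μ α) {t : ℝ} (ht : 0 < t) :
    μ.map (fun x => t⁻¹ • x) = ENNReal.ofReal (t ^ (-α)) • μ := by
  ext A hA
  rw [Measure.map_apply (by fun_prop) hA, Measure.smul_apply, smul_eq_mul, ← h.2 t ht A hA]
  exact congrArg μ (Set.preimage_smul_inv₀ ht.ne' A)

lemma IsTailIndex.tailIntegral_eq (h : IsTailIndex μ α) {φ : E d → ℝ} (hφ : Continuous φ) {r : ℝ}
    (hr : 0 < r) : tailIntegral μ φ r = r ^ (-α) * tailIntegral μ φ 1 := by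
  have hscale := tailIntegral_map_smul (m := μ) (r := 1) hr hφ
  rw [mul_one] at hscale
  rw [← hscale, h.map_smul hr, tailIntegral, tailIntegral, Measure.restrict_smul,
    integral_smul_measure, ENNReal.toReal_ofReal (by positivity), smul_eq_mul]

lemma IsTailIndex.measureReal_lt_norm (h : IsTailIndex μ α) {r : ℝ} (hr : 0 < r) :
    μ.real {x | r < ‖x‖} = r ^ (-α) * μ.real {x | 1 < ‖x‖} := by
  simpa only [tailIntegral_one] using h.tailIntegral_eq (φ := fun _ => 1) continuous_const hr

lemma IsTailIndex.continuousAt_tailIntegral (h : IsTailIndex μ α) {φ : E d → ℝ}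
    (hφ : Continuous φ) {r : ℝ} (hr : 0 < r) : ContinuousAt (tailIntegral μ φ) r := by
  have hpow : ContinuousAt (fun s : ℝ => s ^ (-α) * tailIntegral μ φ 1) r :=
    (Real.continuousAt_rpow_const r (-α) (Or.inl hr.ne')).mul continuousAt_const
  refine hpow.congr ?_
  filter_upwards [lt_mem_nhds hr] with s hs using (h.tailIntegral_eq hφ hs).symm

end TailIndex

section Vague

variable {d : ℕ}

lemma measurable_radial : Measurable (radial : E d → E d) := by
  unfold radial
  fun_prop

lemma norm_radial (x : E d) : ‖radial x‖ = ‖x‖ / (1 + ‖x‖) := by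
  rw [radial, norm_smul, norm_inv, Real.norm_of_nonneg (by positivity)]
  field_simp

lemma direction_radial (x : E d) : ‖radial x‖⁻¹ • radial x = ‖x‖⁻¹ • x :=
  direction_smul (by positivity) x

lemma integral_extend (m : Measure (E d)) {F : E d → ℝ} (hF : Measurable F) (hF0 : F 0 = 0) :
    ∫ y : PuncturedExt d, F y ∂(extend m) = ∫ x, F (radial x) ∂m := by
  have hs : MeasurableSet {y : E d | ‖y‖ ≤ 1 ∧ y ≠ 0} :=
    (measurableSet_le measurable_norm measurable_const).inter (measurableSet_singleton 0).compl
  refine (integral_subtype_comap (μ := m.map radial) hs F).trans ?_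
  rw [setIntegral_map hs hF.aestronglyMeasurable measurable_radial.aemeasurable]
  refine setIntegral_eq_integral_of_forall_compl_eq_zero fun x hx => ?_
  have hle : ‖radial x‖ ≤ 1 := by
    rw [norm_radial, div_le_one (by positivity)]
    linarith
  rw [show radial x = 0 from by_contra fun hne => hx ⟨hle, hne⟩, hF0]

/-- The continuous piecewise linear function that vanishes on `(-∞, u]` and is `1` on `[v, ∞)`,
for `u < v`. -/
noncomputable def cutoff (u v t : ℝ) : ℝ := max 0 (min 1 ((t - u) / (v - u)))

lemma continuous_cutoff (u v : ℝ) : Continuous (cutoff u v) := by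
  unfold cutoff
  fun_prop

lemma cutoff_nonneg (u v t : ℝ) : 0 ≤ cutoff u v t := le_max_left _ _

lemma cutoff_le_one (u v t : ℝ) : cutoff u v t ≤ 1 := max_le zero_le_one (min_le_left _ _)

lemma cutoff_eq_zero {u v t : ℝ} (huv : u < v) (ht : t ≤ u) : cutoff u v t = 0 :=
  max_eq_left <| (min_le_right _ _).trans <|
    div_nonpos_of_nonpos_of_nonneg (by linarith) (by linarith)

lemma cutoff_eq_one {u v t : ℝ} (huv : u < v) (ht : v ≤ t) : cutoff u v t = 1 := by
  rw [cutoff, min_eq_left ((one_le_div (by linarith)).2 (by linarith)), max_eq_right zero_le_one]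

/-- A test function on the punctured compactification, in its ball model: the function
`φ (y / ‖y‖)` of the direction, cut off near the origin. -/
noncomputable def sectorTest (φ : E d → ℝ) (u v : ℝ) (y : E d) : ℝ :=
  φ (‖y‖⁻¹ • y) * cutoff u v ‖y‖

lemma continuous_sectorTest {φ : E d → ℝ} (hφ : Continuous φ) (u v : ℝ) :
    Continuous fun y : PuncturedExt d => sectorTest φ u v y := by
  unfold sectorTest
  have hinv : Continuous fun y : PuncturedExt d => ‖(y : E d)‖⁻¹ :=
    Continuous.inv₀ (by fun_prop) fun y => norm_ne_zero_iff.2 y.2.2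
  have := continuous_cutoff u v
  fun_prop

lemma isCompact_setOf_le_norm_puncturedExt {u : ℝ} (hu : 0 < u) :
    IsCompact {y : PuncturedExt d | u ≤ ‖(y : E d)‖} := by
  have himage : ((↑) : PuncturedExt d → E d) '' {y | u ≤ ‖(y : E d)‖} =
      Metric.closedBall 0 1 ∩ {y | u ≤ ‖y‖} := by
    ext y
    simp only [Set.mem_image, Set.mem_inter_iff, mem_closedBall_zero_iff, Set.mem_ofPred_eq]
    constructor
    · rintro ⟨z, hz, rfl⟩
      exact ⟨z.2.1, hz⟩
    · rintro ⟨hy1, hyu⟩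
      exact ⟨⟨y, hy1, norm_pos_iff.1 (hu.trans_le hyu)⟩, hyu, rfl⟩
  rw [Subtype.isCompact_iff, himage]
  exact (isCompact_closedBall 0 1).inter_right (isClosed_le continuous_const continuous_norm)

lemma hasCompactSupport_sectorTest (φ : E d → ℝ) {u v : ℝ} (hu : 0 < u) (huv : u < v) :
    HasCompactSupport fun y : PuncturedExt d => sectorTest φ u v y := by
  refine HasCompactSupport.intro (isCompact_setOf_le_norm_puncturedExt hu) fun y hy => ?_
  have hyu : ‖(y : E d)‖ ≤ u := (not_le.1 hy).le
  simp [sectorTest, cutoff_eq_zero huv hyu]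

lemma measurable_sectorTest {φ : E d → ℝ} (hφ : Continuous φ) (u v : ℝ) :
    Measurable (sectorTest φ u v) := by
  have := continuous_cutoff u v
  unfold sectorTest
  fun_prop

lemma div_one_add_strictMonoOn : StrictMonoOn (fun r : ℝ => r / (1 + r)) (Set.Ici 0) := by
  intro r hr s hs hrs
  change r / (1 + r) < s / (1 + s)
  rw [div_lt_div_iff₀ (add_pos_of_pos_of_nonneg one_pos hr) (add_pos_of_pos_of_nonneg one_pos hs)]
  linarith

/-- The test function `sectorTest`, read on `ℝ^d` instead of the ball model and increasing from
radius `r` to radius `s`. -/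
noncomputable def radialTest (φ : E d → ℝ) (r s : ℝ) (x : E d) : ℝ :=
  sectorTest φ (r / (1 + r)) (s / (1 + s)) (radial x)

section RadialTest

variable {φ : E d → ℝ} {r s : ℝ}

lemma radialTest_nonneg (hφ0 : 0 ≤ φ) (x : E d) : 0 ≤ radialTest φ r s x :=
  mul_nonneg (hφ0 _) (cutoff_nonneg _ _ _)

lemma radialTest_le_indicator (hφ0 : 0 ≤ φ) (hr : 0 < r) (hrs : r < s) (x : E d) :
    radialTest φ r s x ≤ {x : E d | r < ‖x‖}.indicator (fun x => φ (‖x‖⁻¹ • x)) x := by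
  rw [radialTest, sectorTest, direction_radial, norm_radial]
  by_cases hx : r < ‖x‖
  · rw [Set.indicator_of_mem (by exact hx)]
    exact mul_le_of_le_one_right (hφ0 _) (cutoff_le_one _ _ _)
  · rw [Set.indicator_of_notMem (by exact hx), cutoff_eq_zero
      (div_one_add_strictMonoOn hr.le (hr.trans hrs).le hrs)
      (div_one_add_strictMonoOn.monotoneOn (norm_nonneg x) hr.le (not_lt.1 hx)), mul_zero]

lemma indicator_le_radialTest (hφ0 : 0 ≤ φ) (hr : 0 < r) (hrs : r < s) (x : E d) :
    {x : E d | s < ‖x‖}.indicator (fun x => φ (‖x‖⁻¹ • x)) x ≤ radialTest φ r s x := by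
  by_cases hx : s < ‖x‖
  · rw [Set.indicator_of_mem (by exact hx), radialTest, sectorTest, direction_radial, norm_radial,
      cutoff_eq_one (div_one_add_strictMonoOn hr.le (hr.trans hrs).le hrs)
        (div_one_add_strictMonoOn.monotoneOn (hr.trans hrs).le (norm_nonneg x) (le_of_lt hx)),
      mul_one]
  · rw [Set.indicator_of_notMem (by exact hx)]
    exact radialTest_nonneg hφ0 x

variable {m : Measure (E d)} (hm : ∀ r, 0 < r → m {x | r < ‖x‖} < ⊤)

include hm

lemma integrable_indicator_direction (hφ : Continuous φ) (hr : 0 < r) :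
    Integrable ({x : E d | r < ‖x‖}.indicator fun x => φ (‖x‖⁻¹ • x)) m :=
  (integrableOn_direction (hm r hr) hφ hr.le).integrable_indicator (measurableSet_lt_norm r)

lemma integrable_radialTest (hφ : Continuous φ) (hφ0 : 0 ≤ φ) (hr : 0 < r) (hrs : r < s) :
    Integrable (radialTest φ r s) m := by
  refine (integrable_indicator_direction hm hφ hr).mono'
    ((measurable_sectorTest hφ _ _).comp measurable_radial).aestronglyMeasurable
    (Eventually.of_forall fun x => ?_)
  rw [Real.norm_of_nonneg (radialTest_nonneg hφ0 x)]
  exact radialTest_le_indicator hφ0 hr hrs x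

lemma tailIntegral_le_integral_radialTest (hφ : Continuous φ) (hφ0 : 0 ≤ φ) (hr : 0 < r)
    (hrs : r < s) : tailIntegral m φ s ≤ ∫ x, radialTest φ r s x ∂m := by
  rw [tailIntegral, ← integral_indicator (measurableSet_lt_norm s)]
  exact integral_mono (integrable_indicator_direction hm hφ (hr.trans hrs))
    (integrable_radialTest hm hφ hφ0 hr hrs) (indicator_le_radialTest hφ0 hr hrs)

lemma integral_radialTest_le_tailIntegral (hφ : Continuous φ) (hφ0 : 0 ≤ φ) (hr : 0 < r)
    (hrs : r < s) : ∫ x, radialTest φ r s x ∂m ≤ tailIntegral m φ r := by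
  rw [tailIntegral, ← integral_indicator (measurableSet_lt_norm r)]
  exact integral_mono (integrable_radialTest hm hφ hφ0 hr hrs)
    (integrable_indicator_direction hm hφ hr) (radialTest_le_indicator hφ0 hr hrs)

end RadialTest

lemma eventually_exists_mem_gap {a : ℕ → ℝ} (ha : Tendsto a atTop atTop) {p : ℕ → Prop}
    (hp : ∀ᶠ n in atTop, p n) : ∀ᶠ t in atTop, ∃ n, p n ∧ a n ≤ t ∧ t < a (n + 1) := by
  obtain ⟨N, hN⟩ := eventually_atTop.1 hp
  filter_upwards [eventually_ge_atTop (a N)] with t ht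
  by_contra! hgap
  have hle : ∀ n ≥ N, a n ≤ t := fun n hn => by
    induction n, hn using Nat.le_induction with
    | base => exact ht
    | succ n hn ih => exact hgap n (hN n hn) ih
  obtain ⟨n, hn, hnN⟩ := ((ha.eventually_gt_atTop t).and (eventually_ge_atTop N)).exists
  exact (hle n hnN).not_gt hn

lemma tendsto_of_squeeze_on_gaps {a : ℕ → ℝ} (ha : Tendsto a atTop atTop) {f : ℝ → ℝ}
    {u v : ℕ → ℝ} {b : ℝ} (hu : Tendsto u atTop (𝓝 b)) (hv : Tendsto v atTop (𝓝 b))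
    (hf : ∀ᶠ n in atTop, ∀ t, a n ≤ t → t < a (n + 1) → u n ≤ f t ∧ f t ≤ v n) :
    Tendsto f atTop (𝓝 b) := by
  refine tendsto_order.2 ⟨fun x hx => ?_, fun x hx => ?_⟩
  · filter_upwards [eventually_exists_mem_gap ha ((hu.eventually_const_lt hx).and hf)]
      with t ⟨n, ⟨hxn, hn⟩, hnt, htn⟩
    exact hxn.trans_le (hn t hnt htn).1
  · filter_upwards [eventually_exists_mem_gap ha ((hv.eventually_lt_const hx).and hf)]
      with t ⟨n, ⟨hxn, hn⟩, hnt, htn⟩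
    exact (hn t hnt htn).2.trans_lt hxn

/-- Since `(n + 1) / n → 1`, monotonicity fills the gaps of the sequence `a`, whatever their
lengths. -/
lemma tendsto_div_of_antitoneOn {a : ℕ → ℝ} (ha : Tendsto a atTop atTop) {F G : ℝ → ℝ}
    (hF : AntitoneOn F (Set.Ici 0)) (hF0 : 0 ≤ F) (hG : AntitoneOn G (Set.Ici 0))
    (hG0 : ∀ t, 0 < G t) {b c : ℝ} (hFlim : Tendsto (fun n : ℕ => n * F (a n)) atTop (𝓝 b))
    (hGlim : Tendsto (fun n : ℕ => n * G (a n)) atTop (𝓝 c)) (hc : c ≠ 0) :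
    Tendsto (fun t => F t / G t) atTop (𝓝 (b / c)) := by
  have hsucc := tendsto_add_atTop_nat 1
  have hratio := tendsto_natCast_div_add_atTop (1 : ℝ)
  have hlower := ((hFlim.comp hsucc).div hGlim hc).mul hratio
  have hupper := (hFlim.div (hGlim.comp hsucc) hc).div hratio one_ne_zero
  rw [mul_one] at hlower
  rw [div_one] at hupper
  refine tendsto_of_squeeze_on_gaps ha hlower hupper ?_
  filter_upwards [eventually_gt_atTop 0, ha.eventually_ge_atTop 0] with n hn han t hnt htn
  have hn0 : (n : ℝ) ≠ 0 := by positivity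
  have hn1 : (n : ℝ) + 1 ≠ 0 := by positivity
  have ht : 0 ≤ t := han.trans hnt
  have hG1 := (hG0 (a n)).ne'
  have hG2 := (hG0 (a (n + 1))).ne'
  simp only [Function.comp_apply, Pi.div_apply, Nat.cast_add, Nat.cast_one]
  constructor
  · calc _ = F (a (n + 1)) / G (a n) := by field_simp
      _ ≤ F t / G t := div_le_div₀ (hF0 t) (hF ht (ht.trans htn.le) htn.le) (hG0 t) (hG han ht hnt)
  · calc F t / G t ≤ F (a n) / G (a (n + 1)) :=
          div_le_div₀ (hF0 _) (hF han ht hnt) (hG0 _) (hG ht (ht.trans htn.le) htn.le)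
      _ = _ := by field_simp

/-- The tails of `ρ` vary regularly: the measures `A ↦ ρ (t A) / ρ {x | t < ‖x‖}` converge to
`μ / μ {x | 1 < ‖x‖}` as `t → ∞` over all reals, when tested on the tails with weights depending
on the direction. -/
structure HasRegularTail (ρ μ : Measure (E d)) : Prop where
  tail_pos : ∀ t, 0 < ρ.real {x | t < ‖x‖}
  limit_tail_pos : 0 < μ.real {x | 1 < ‖x‖}
  limit_tail_lt_top : ∀ r, 0 < r → μ {x | r < ‖x‖} < ⊤
  tendsto_tailIntegral : ∀ φ : E d → ℝ, Continuous φ → ∀ r, 0 < r →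
    Tendsto (fun t => tailIntegral ρ φ (t * r) / ρ.real {x | t < ‖x‖}) atTop
      (𝓝 (tailIntegral μ φ r / μ.real {x | 1 < ‖x‖}))

namespace HasPowerLawTail

variable {Ω : Type*} [MeasurableSpace Ω] {P : Measure Ω} {H : Ω → E d} {a : ℕ → ℝ}
  {μ : Measure (E d)} {α : ℝ} (h : HasPowerLawTail P H a μ)

include h

lemma measureReal_one_lt_norm_pos (hα : IsTailIndex μ α) : 0 < μ.real {x | 1 < ‖x‖} := by
  refine measureReal_nonneg.lt_of_ne' fun hzero => h.non_null ?_
  have hnull (r : ℝ) (hr : 0 < r) : μ {x | r < ‖x‖} = 0 := by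
    rw [← measureReal_eq_zero_iff (h.radon r hr).ne, hα.measureReal_lt_norm hr, hzero, mul_zero]
  rw [← Measure.measure_univ_eq_zero, ← iUnion_singleton_zero_union_lt_norm]
  exact measure_iUnion_null fun _ =>
    measure_union_null h.not_charge_zero (hnull _ Nat.one_div_pos_of_nat)

lemma sigmaFinite : SigmaFinite μ where
  out' := ⟨{
    set := fun n => {0} ∪ {x | 1 / ((n : ℝ) + 1) < ‖x‖}
    set_mem := fun _ => trivial
    finite := fun _ => measure_union_lt_top (h.not_charge_zero ▸ ENNReal.zero_lt_top)
      (h.radon _ Nat.one_div_pos_of_nat)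
    spanning := iUnion_singleton_zero_union_lt_norm }⟩

variable (hH : Measurable H)

include hH

lemma tendsto_integral_radialTest {φ : E d → ℝ} (hφ : Continuous φ) {r s : ℝ} (hr : 0 < r)
    (hrs : r < s) :
    Tendsto (fun n : ℕ => n * ∫ x, radialTest φ r s x ∂((P.map H).map fun x => (a n)⁻¹ • x))
      atTop (𝓝 (∫ x, radialTest φ r s x ∂μ)) := by
  have hu : 0 < r / (1 + r) := by positivity
  have huv := div_one_add_strictMonoOn hr.le (hr.trans hrs).le hrs
  have hvague := h.vague _ (continuous_sectorTest hφ _ _) (hasCompactSupport_sectorTest φ hu huv)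
  have hzero : sectorTest φ (r / (1 + r)) (s / (1 + s)) 0 = 0 := by
    simp [sectorTest, cutoff_eq_zero huv hu.le]
  simp only [integral_extend _ (measurable_sectorTest hφ _ _) hzero, integral_smul_measure]
    at hvague
  refine hvague.congr fun n => ?_
  rw [Measure.map_map (by fun_prop) hH]
  simp [Function.comp_def, radialTest]

variable [IsProbabilityMeasure P] (hα : IsTailIndex μ α)

include hα

lemma tendsto_nat_mul_tailIntegral {φ : E d → ℝ} (hφ : Continuous φ) (hφ0 : 0 ≤ φ) {r : ℝ}
    (hr : 0 < r) :
    Tendsto (fun n : ℕ => n * tailIntegral (P.map H) φ (a n * r)) atTop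
      (𝓝 (tailIntegral μ φ r)) := by
  have := Measure.isProbabilityMeasure_map (μ := P) hH.aemeasurable
  have hcont := hα.continuousAt_tailIntegral hφ hr
  have hfin (n : ℕ) (r : ℝ) (_ : 0 < r) :
      ((P.map H).map fun x => (a n)⁻¹ • x) {x | r < ‖x‖} < ⊤ := measure_lt_top _ _
  refine tendsto_order.2 ⟨fun b hb => ?_, fun b hb => ?_⟩
  · obtain ⟨s, hs, hrs : r < s⟩ := (((hcont.eventually (lt_mem_nhds hb)).filter_mono
      (nhdsWithin_le_nhds (s := Set.Ioi r))).and self_mem_nhdsWithin).exists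
    have hbs := hs.trans_le (tailIntegral_le_integral_radialTest h.radon hφ hφ0 hr hrs)
    filter_upwards [(h.tendsto_integral_radialTest hH hφ hr hrs).eventually_const_lt hbs,
      h.scale_tendsto.eventually_gt_atTop 0] with n hn han
    refine hn.trans_le (mul_le_mul_of_nonneg_left ?_ n.cast_nonneg)
    rw [← tailIntegral_map_smul han hφ]
    exact integral_radialTest_le_tailIntegral (hfin n) hφ hφ0 hr hrs
  · obtain ⟨s, ⟨hs, hsr : s < r⟩, hs0⟩ := (((hcont.eventually (gt_mem_nhds hb)).filter_mono
      (nhdsWithin_le_nhds (s := Set.Iio r))).and self_mem_nhdsWithin |>.and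
      ((lt_mem_nhds hr).filter_mono nhdsWithin_le_nhds)).exists
    have hsb := (integral_radialTest_le_tailIntegral h.radon hφ hφ0 hs0 hsr).trans_lt hs
    filter_upwards [(h.tendsto_integral_radialTest hH hφ hs0 hsr).eventually_lt_const hsb,
      h.scale_tendsto.eventually_gt_atTop 0] with n hn han
    refine lt_of_le_of_lt (mul_le_mul_of_nonneg_left ?_ n.cast_nonneg) hn
    rw [← tailIntegral_map_smul han hφ]
    exact tailIntegral_le_integral_radialTest (hfin n) hφ hφ0 hs0 hsr

lemma tendsto_nat_mul_measureReal_lt_norm :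
    Tendsto (fun n : ℕ => n * (P.map H).real {x | a n < ‖x‖}) atTop
      (𝓝 (μ.real {x | 1 < ‖x‖})) := by
  simpa only [tailIntegral_one, mul_one] using h.tendsto_nat_mul_tailIntegral hH hα
    (φ := fun _ => 1) continuous_const (fun _ => zero_le_one) one_pos

lemma measureReal_lt_norm_pos (t : ℝ) : 0 < (P.map H).real {x | t < ‖x‖} := by
  have := Measure.isProbabilityMeasure_map (μ := P) hH.aemeasurable
  obtain ⟨n, hn, htn⟩ := (((h.tendsto_nat_mul_measureReal_lt_norm hH hα).eventually_const_lt
    (h.measureReal_one_lt_norm_pos hα)).and (h.scale_tendsto.eventually_ge_atTop t)).exists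
  exact (pos_of_mul_pos_right hn n.cast_nonneg).trans_le (antitone_measureReal_lt_norm htn)

lemma tendsto_tailIntegral_div_of_nonneg {φ : E d → ℝ} (hφ : Continuous φ) (hφ0 : 0 ≤ φ) {r : ℝ}
    (hr : 0 < r) :
    Tendsto (fun t => tailIntegral (P.map H) φ (t * r) / (P.map H).real {x | t < ‖x‖}) atTop
      (𝓝 (tailIntegral μ φ r / μ.real {x | 1 < ‖x‖})) := by
  have := Measure.isProbabilityMeasure_map (μ := P) hH.aemeasurable
  refine tendsto_div_of_antitoneOn h.scale_tendsto (fun s hs t ht hst => ?_)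
    (fun _ => tailIntegral_nonneg hφ0) (antitone_measureReal_lt_norm.antitoneOn _)
    (h.measureReal_lt_norm_pos hH hα) (h.tendsto_nat_mul_tailIntegral hH hα hφ hφ0 hr)
    (h.tendsto_nat_mul_measureReal_lt_norm hH hα) (h.measureReal_one_lt_norm_pos hα).ne'
  exact antitoneOn_tailIntegral hφ hφ0 (mul_nonneg hs hr.le) (mul_nonneg ht hr.le)
    (mul_le_mul_of_nonneg_right hst hr.le)

theorem hasRegularTail : HasRegularTail (P.map H) μ where
  tail_pos := h.measureReal_lt_norm_pos hH hα
  limit_tail_pos := h.measureReal_one_lt_norm_pos hα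
  limit_tail_lt_top := h.radon
  tendsto_tailIntegral φ hφ r hr := by
    have := Measure.isProbabilityMeasure_map (μ := P) hH.aemeasurable
    have hpos : Continuous fun x => max (φ x) 0 := by fun_prop
    have hneg : Continuous fun x => max (-φ x) 0 := by fun_prop
    have hsplit : φ = fun x => max (φ x) 0 - max (-φ x) 0 :=
      funext fun x => (max_zero_sub_max_neg_zero_eq_self (φ x)).symm
    have hlim := (h.tendsto_tailIntegral_div_of_nonneg hH hα hpos (fun _ => le_max_right _ _)
      hr).sub (h.tendsto_tailIntegral_div_of_nonneg hH hα hneg (fun _ => le_max_right _ _) hr)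
    rw [← sub_div, ← tailIntegral_sub (h.radon r hr) hpos hneg hr.le, ← hsplit] at hlim
    refine hlim.congr' ?_
    filter_upwards [eventually_gt_atTop 0] with t ht
    rw [← sub_div, ← tailIntegral_sub (measure_lt_top _ _) hpos hneg (by positivity), ← hsplit]

end HasPowerLawTail

end Vague

section Potter

lemma apply_mul_two_pow_le {F : ℝ → ℝ} {K t₀ : ℝ} (hK : 0 ≤ K) (ht₀ : 0 ≤ t₀)
    (hF : ∀ u ≥ t₀, F (u * 2) ≤ K * F u) (k : ℕ) {u : ℝ} (hu : t₀ ≤ u) :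
    F (u * 2 ^ k) ≤ K ^ k * F u := by
  induction k with
  | zero => simp
  | succ k ih =>
    have hle : t₀ ≤ u * 2 ^ k :=
      hu.trans (le_mul_of_one_le_right (ht₀.trans hu) (one_le_pow₀ one_le_two))
    calc F (u * 2 ^ (k + 1)) = F (u * 2 ^ k * 2) := by ring_nf
      _ ≤ K * F (u * 2 ^ k) := hF _ hle
      _ ≤ K * (K ^ k * F u) := by gcongr
      _ = K ^ (k + 1) * F u := by ring

lemma rpow_pow_comm {x y : ℝ} (hx : 0 ≤ x) (k : ℕ) : (x ^ y) ^ k = (x ^ k) ^ y := by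
  rw [← Real.rpow_natCast, ← Real.rpow_natCast, ← Real.rpow_mul hx, ← Real.rpow_mul hx, mul_comm]

variable {G : ℝ → ℝ} {α : ℝ}

lemma exists_apply_mul_le_rpow_mul (hG : Antitone G) (hpos : ∀ t, 0 < G t)
    (hlim : Tendsto (fun t => G (t * 2) / G t) atTop (𝓝 (2 ^ (-α)))) {q : ℝ} (hq : 0 < q)
    (hqα : q < α) :
    ∃ t₀, ∀ t ≥ t₀, ∀ s ≥ 1, G (t * s) ≤ 2 ^ q * s ^ (-q) * G t := by
  have hlt : (2 : ℝ) ^ (-α) < 2 ^ (-q) :=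
    Real.rpow_lt_rpow_of_exponent_lt one_lt_two (by linarith)
  obtain ⟨t₀, ht₀⟩ := eventually_atTop.1
    ((hlim.eventually_lt_const hlt).and (eventually_ge_atTop 0))
  have hdouble : ∀ u ≥ t₀, G (u * 2) ≤ 2 ^ (-q) * G u :=
    fun u hu => ((div_lt_iff₀ (hpos u)).1 (ht₀ u hu).1).le
  refine ⟨t₀, fun t ht s hs => ?_⟩
  have ht0 : 0 ≤ t := (ht₀ t ht).2
  obtain ⟨k, hks, hsk⟩ := exists_nat_pow_near hs one_lt_two
  have hpow : ((2 : ℝ) ^ (-q)) ^ k ≤ 2 ^ q * s ^ (-q) := by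
    calc ((2 : ℝ) ^ (-q)) ^ k = 2 ^ q * (2 ^ (k + 1)) ^ (-q) := by
          rw [← rpow_pow_comm zero_le_two, pow_succ, mul_left_comm, ← Real.rpow_add two_pos]
          simp
      _ ≤ 2 ^ q * s ^ (-q) := mul_le_mul_of_nonneg_left
          (Real.rpow_le_rpow_of_nonpos (by linarith) hsk.le (by linarith)) (by positivity)
  calc G (t * s) ≤ G (t * 2 ^ k) := hG (by gcongr)
    _ ≤ (2 ^ (-q)) ^ k * G t :=
      apply_mul_two_pow_le (by positivity) (ht₀ t₀ le_rfl).2 hdouble k ht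
    _ ≤ 2 ^ q * s ^ (-q) * G t := mul_le_mul_of_nonneg_right hpow (hpos t).le

lemma exists_apply_le_rpow_mul_apply_mul (hG : Antitone G) (hpos : ∀ t, 0 < G t)
    (hlim : Tendsto (fun t => G (t * 2) / G t) atTop (𝓝 (2 ^ (-α)))) {p : ℝ} (hp : 0 < p)
    (hαp : α < p) :
    ∃ t₀, 0 < t₀ ∧ ∀ t ≥ t₀, ∀ s ≥ 1, G t ≤ 2 ^ p * s ^ p * G (t * s) := by
  have hlt : (2 : ℝ) ^ (-p) < 2 ^ (-α) :=
    Real.rpow_lt_rpow_of_exponent_lt one_lt_two (by linarith)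
  obtain ⟨t₀, ht₀⟩ := eventually_atTop.1
    ((hlim.eventually_const_lt hlt).and (eventually_gt_atTop 0))
  have hdouble : ∀ u ≥ t₀, (G (u * 2))⁻¹ ≤ 2 ^ p * (G u)⁻¹ := by
    intro u hu
    have hmul : 2 ^ (-p) * G u < G (u * 2) := (lt_div_iff₀ (hpos u)).1 (ht₀ u hu).1
    have := inv_anti₀ (mul_pos (by positivity) (hpos u)) hmul.le
    rwa [mul_inv, Real.rpow_neg zero_le_two, inv_inv] at this
  refine ⟨t₀, (ht₀ t₀ le_rfl).2, fun t ht s hs => ?_⟩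
  have ht0 : 0 < t := (ht₀ t ht).2
  obtain ⟨k, hks, hsk⟩ := exists_nat_pow_near hs one_lt_two
  have hpow : ((2 : ℝ) ^ p) ^ (k + 1) ≤ 2 ^ p * s ^ p := by
    rw [pow_succ', rpow_pow_comm zero_le_two]
    gcongr
  have hinv := apply_mul_two_pow_le (F := fun t => (G t)⁻¹) (by positivity)
    (ht₀ t₀ le_rfl).2.le hdouble (k + 1) ht
  rw [inv_le_iff_one_le_mul₀ (hpos _), mul_right_comm, ← div_eq_mul_inv,
    one_le_div (hpos t)] at hinv
  calc G t ≤ (2 ^ p) ^ (k + 1) * G (t * 2 ^ (k + 1)) := hinv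
    _ ≤ 2 ^ p * s ^ p * G (t * s) :=
      mul_le_mul hpow (hG (by gcongr)) (hpos _).le (by positivity)

lemma exists_apply_mul_le_rpow_mul_of_le_one (hG : Antitone G) (hpos : ∀ t, 0 < G t)
    (hlim : Tendsto (fun t => G (t * 2) / G t) atTop (𝓝 (2 ^ (-α)))) {p : ℝ} (hp : 0 < p)
    (hαp : α < p) :
    ∃ C t₀, ∀ t ≥ t₀, ∀ s, 0 < s → s ≤ 1 → G (t * s) ≤ C * s ^ (-p) * G t := by
  obtain ⟨t₀, ht₀, hlow⟩ := exists_apply_le_rpow_mul_apply_mul hG hpos hlim hp hαp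
  have hG₀ := hpos t₀
  have hG0 := hpos 0
  refine ⟨G 0 / G t₀ * 2 ^ p, t₀, fun t htt₀ s hs hs1 => ?_⟩
  have hGt := hpos t
  have ht : 0 < t := ht₀.trans_le htt₀
  set v := max (t * s) t₀ with hv
  have hv0 : 0 < v := ht₀.trans_le (le_max_right _ _)
  have hvt : v ≤ t := max_le (mul_le_of_le_one_right ht.le hs1) htt₀
  have hGv : G (t * s) ≤ G 0 / G t₀ * G v := by
    rcases max_choice (t * s) t₀ with hmax | hmax
    · rw [hv, hmax]
      exact le_mul_of_one_le_left (hpos _).le ((one_le_div hG₀).2 (hG ht₀.le))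
    · rw [hv, hmax, div_mul_cancel₀ _ hG₀.ne']
      exact hG (by positivity)
  have hts : (t / v) ^ p ≤ s ^ (-p) := by
    rw [Real.rpow_neg hs.le, ← Real.inv_rpow hs.le]
    refine Real.rpow_le_rpow (by positivity) ?_ hp.le
    rw [div_le_iff₀ hv0, inv_mul_eq_div, le_div_iff₀ hs]
    exact le_max_left _ _
  have hlow' := hlow v (le_max_right _ _) (t / v) ((one_le_div hv0).2 hvt)
  rw [mul_div_cancel₀ t hv0.ne'] at hlow'
  calc G (t * s) ≤ G 0 / G t₀ * (2 ^ p * (t / v) ^ p * G t) := hGv.trans (by gcongr)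
    _ ≤ G 0 / G t₀ * (2 ^ p * s ^ (-p) * G t) := by gcongr
    _ = G 0 / G t₀ * 2 ^ p * s ^ (-p) * G t := by ring

theorem exists_potter_bound (hG : Antitone G) (hpos : ∀ t, 0 < G t)
    (hlim : Tendsto (fun t => G (t * 2) / G t) atTop (𝓝 (2 ^ (-α)))) {p q : ℝ} (hq : 0 < q)
    (hqα : q < α) (hαp : α < p) :
    ∃ C, 0 ≤ C ∧ ∀ᶠ t in atTop, ∀ s, 0 < s → G (t * s) ≤ C * (s ^ (-p) + s ^ (-q)) * G t := by
  obtain ⟨t₁, hlarge⟩ := exists_apply_mul_le_rpow_mul hG hpos hlim hq hqα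
  obtain ⟨C, t₀, hsmall⟩ := exists_apply_mul_le_rpow_mul_of_le_one hG hpos hlim
    (hq.trans (hqα.trans hαp)) hαp
  refine ⟨max (2 ^ q) C, by positivity, ?_⟩
  filter_upwards [eventually_ge_atTop t₁, eventually_ge_atTop t₀] with t ht₁ ht₀ s hs
  have hGt := hpos t
  rcases le_total 1 s with h1s | hs1
  · calc G (t * s) ≤ 2 ^ q * s ^ (-q) * G t := hlarge t ht₁ s h1s
      _ ≤ _ := by
        gcongr
        · exact le_max_left _ _
        · exact le_add_of_nonneg_left (by positivity)
  · calc G (t * s) ≤ C * s ^ (-p) * G t := hsmall t ht₀ s hs hs1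
      _ ≤ _ := by
        gcongr
        · exact le_max_right _ _
        · exact le_add_of_nonneg_right (by positivity)

end Potter

/-! ### Radial primitives -/

section RadialPrimitive

variable {V : Type*} [NormedAddCommGroup V] [NormedSpace ℝ V]

/-- The function vanishing at the origin whose derivative at `s • u` in the direction of the unit
vector `u` is `ψ s u`. -/
noncomputable def radialPrimitive (ψ : ℝ → V → ℝ) (x : V) : ℝ :=
  ∫ s in Set.Ioo 0 ‖x‖, ψ s (‖x‖⁻¹ • x)

/-- The function `ψ s (x / ‖x‖)` on the set `s < ‖x‖` of pairs `(s, x)`: integrated over `s > 0`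
it gives the radial primitive, integrated over `x` the tail integral. -/
noncomputable def radialLayer (ψ : ℝ → V → ℝ) (s : ℝ) (x : V) : ℝ :=
  {x | s < ‖x‖}.indicator (fun x => ψ s (‖x‖⁻¹ • x)) x

lemma integral_radialLayer_radius (ψ : ℝ → V → ℝ) (x : V) :
    ∫ s in Set.Ioi 0, radialLayer ψ s x = radialPrimitive ψ x := by
  have hlayer : (fun s => radialLayer ψ s x) =
      (Set.Iio ‖x‖).indicator fun s => ψ s (‖x‖⁻¹ • x) := by
    ext s
    simp [radialLayer, Set.indicator_apply]
  rw [hlayer, setIntegral_indicator measurableSet_Iio, Set.Ioi_inter_Iio, radialPrimitive]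

variable [MeasurableSpace V]

/-- A radial density, continuous in the direction, which on the unit sphere is bounded by a function
of the radius alone. -/
structure IsRadialDensity (ψ : ℝ → V → ℝ) (B : ℝ → ℝ) : Prop where
  measurable : Measurable (Function.uncurry ψ)
  continuous : ∀ s, Continuous (ψ s)
  measurable_bound : Measurable B
  bound_nonneg : 0 ≤ B
  abs_le : ∀ s, 0 < s → ∀ u, ‖u‖ = 1 → |ψ s u| ≤ B s

lemma integral_radialLayer [OpensMeasurableSpace V] (m : Measure V) (ψ : ℝ → V → ℝ) (s : ℝ) :
    ∫ x, radialLayer ψ s x ∂m = tailIntegral m (ψ s) s :=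
  integral_indicator (measurableSet_lt_norm s)

namespace IsRadialDensity

variable {ψ : ℝ → V → ℝ} {B : ℝ → ℝ} (hψ : IsRadialDensity ψ B)

include hψ

lemma norm_radialLayer_le {s : ℝ} (hs : 0 < s) (x : V) :
    ‖radialLayer ψ s x‖ ≤ {x : V | s < ‖x‖}.indicator (fun _ => B s) x := by
  rw [radialLayer, norm_indicator_eq_indicator_norm]
  exact Set.indicator_le_indicator' fun hx => hψ.abs_le s hs _ (norm_direction hs.le hx)

variable [BorelSpace V] [ProperSpace V]

lemma measurable_radialLayer : Measurable (Function.uncurry (radialLayer ψ)) := by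
  have hS : MeasurableSet {p : ℝ × V | p.1 < ‖p.2‖} :=
    measurableSet_lt measurable_fst measurable_snd.norm
  have hdir : Measurable fun p : ℝ × V => (p.1, ‖p.2‖⁻¹ • p.2) := by fun_prop
  exact (hψ.measurable.comp hdir).indicator hS

variable {m : Measure V} [SFinite m]

lemma stronglyMeasurable_tailIntegral : StronglyMeasurable fun s => tailIntegral m (ψ s) s := by
  simp_rw [← integral_radialLayer]
  exact hψ.measurable_radialLayer.stronglyMeasurable.integral_prod_right

variable (hm : ∀ r, 0 < r → m {x | r < ‖x‖} < ⊤)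
  (hint : IntegrableOn (fun s => B s * m.real {x | s < ‖x‖}) (Set.Ioi 0))

include hm hint

lemma integrable_radialLayer :
    Integrable (Function.uncurry (radialLayer ψ)) ((volume.restrict (Set.Ioi 0)).prod m) := by
  have hmeas := hψ.measurable_radialLayer.aestronglyMeasurable
    (μ := (volume.restrict (Set.Ioi (0 : ℝ))).prod m)
  have hbound (s : ℝ) (hs : 0 < s) :
      Integrable ({x : V | s < ‖x‖}.indicator fun _ => B s) m :=
    (integrable_indicator_iff (measurableSet_lt_norm s)).2 (integrableOn_const (hm s hs).ne)
  rw [integrable_prod_iff hmeas]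
  refine ⟨?_, hint.mono' hmeas.norm.integral_prod_right' ?_⟩
  · filter_upwards [ae_restrict_mem measurableSet_Ioi] with s hs
    exact (hbound s hs).mono' (hψ.measurable_radialLayer.comp measurable_prodMk_left
      ).aestronglyMeasurable (Eventually.of_forall (hψ.norm_radialLayer_le hs))
  · filter_upwards [ae_restrict_mem measurableSet_Ioi] with s hs
    rw [Real.norm_of_nonneg (integral_nonneg fun _ => norm_nonneg _)]
    calc ∫ x, ‖radialLayer ψ s x‖ ∂m ≤ ∫ x, {x : V | s < ‖x‖}.indicator (fun _ => B s) x ∂m :=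
          integral_mono_of_nonneg (Eventually.of_forall fun _ => norm_nonneg _) (hbound s hs)
            (Eventually.of_forall (hψ.norm_radialLayer_le hs))
      _ = B s * m.real {x | s < ‖x‖} := by
          rw [integral_indicator_const _ (measurableSet_lt_norm s), smul_eq_mul, mul_comm]

lemma integrable_radialPrimitive : Integrable (radialPrimitive ψ) m := by
  simpa only [Function.uncurry_apply_pair, integral_radialLayer_radius] using
    (hψ.integrable_radialLayer hm hint).integral_prod_right

lemma integral_radialPrimitive :
    ∫ x, radialPrimitive ψ x ∂m = ∫ s in Set.Ioi 0, tailIntegral m (ψ s) s := by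
  simp_rw [← integral_radialLayer_radius, ← integral_radialLayer]
  exact (integral_integral_swap (hψ.integrable_radialLayer hm hint)).symm

end IsRadialDensity

end RadialPrimitive

section RegularTail

section Rescaling

variable {V : Type*} [NormedAddCommGroup V] [NormedSpace ℝ V] [MeasurableSpace V] [BorelSpace V]
  [ProperSpace V] {ψ : ℝ → V → ℝ} {B : ℝ → ℝ} {m : Measure V} [IsFiniteMeasure m] {t : ℝ}

lemma IsRadialDensity.stronglyMeasurable_tailIntegral_mul (hψ : IsRadialDensity ψ B) (ht : 0 < t) :
    StronglyMeasurable fun s => tailIntegral m (ψ s) (t * s) := by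
  simpa only [tailIntegral_map_smul ht (hψ.continuous _)] using
    hψ.stronglyMeasurable_tailIntegral (m := m.map fun x => t⁻¹ • x)

lemma IsRadialDensity.integral_radialPrimitive_inv_smul (hψ : IsRadialDensity ψ B) (ht : 0 < t)
    (hint : IntegrableOn (fun s => B s * m.real {x | t * s < ‖x‖}) (Set.Ioi 0)) :
    ∫ x, radialPrimitive ψ (t⁻¹ • x) ∂m = ∫ s in Set.Ioi 0, tailIntegral m (ψ s) (t * s) := by
  have htail (s : ℝ) : (m.map fun x => t⁻¹ • x).real {x | s < ‖x‖} = m.real {x | t * s < ‖x‖} := by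
    simpa only [tailIntegral_one] using
      tailIntegral_map_smul (m := m) (φ := fun _ => 1) (r := s) ht continuous_const
  simp_rw [← htail] at hint
  have hfin (r : ℝ) (_ : 0 < r) : (m.map fun x => t⁻¹ • x) {x | r < ‖x‖} < ⊤ := measure_lt_top _ _
  have hmeas := (hψ.integrable_radialPrimitive hfin hint).aestronglyMeasurable
  rw [← integral_map (by fun_prop) hmeas, hψ.integral_radialPrimitive hfin hint]
  simp_rw [tailIntegral_map_smul ht (hψ.continuous _)]

end Rescaling

variable {d : ℕ} {ρ μ : Measure (E d)} {α p q : ℝ} (h : HasRegularTail ρ μ)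
  (hα : IsTailIndex μ α)

include h hα in
lemma HasRegularTail.exists_potter_bound [IsFiniteMeasure ρ] (hq : 0 < q) (hqα : q < α)
    (hαp : α < p) :
    ∃ C, 0 ≤ C ∧ ∀ᶠ t in atTop, ∀ s, 0 < s →
      ρ.real {x | t * s < ‖x‖} ≤ C * (s ^ (-p) + s ^ (-q)) * ρ.real {x | t < ‖x‖} := by
  refine TruncatedTails.exists_potter_bound antitone_measureReal_lt_norm h.tail_pos ?_ hq hqα hαp
  have hlim := h.tendsto_tailIntegral (fun _ => 1) continuous_const 2 two_pos
  simp only [tailIntegral_one] at hlim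
  rwa [hα.measureReal_lt_norm two_pos, mul_div_cancel_right₀ _ h.limit_tail_pos.ne'] at hlim

variable {ψ : ℝ → E d → ℝ} {B : ℝ → ℝ} (hψ : IsRadialDensity ψ B) (hq : 0 < q) (hqα : q < α)
  (hαp : α < p) (hint : IntegrableOn (fun s => B s * (s ^ (-p) + s ^ (-q))) (Set.Ioi 0))

include hα hψ hqα hαp hint

lemma IsTailIndex.integrableOn_mul_tail :
    IntegrableOn (fun s => B s * μ.real {x | s < ‖x‖}) (Set.Ioi 0) := by
  have hmeas : Measurable fun s => B s * (s ^ (-α) * μ.real {x : E d | 1 < ‖x‖}) := by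
    have := hψ.measurable_bound
    fun_prop
  refine IntegrableOn.congr_fun (f := fun s => B s * (s ^ (-α) * μ.real {x : E d | 1 < ‖x‖}))
    ?_ (fun s hs => by rw [hα.measureReal_lt_norm hs]) measurableSet_Ioi
  refine (hint.mul_const (μ.real {x : E d | 1 < ‖x‖})).mono' hmeas.aestronglyMeasurable ?_
  filter_upwards [ae_restrict_mem measurableSet_Ioi] with s (hs : 0 < s)
  have hB : 0 ≤ B s := hψ.bound_nonneg s
  have hpow : s ^ (-α) ≤ s ^ (-p) + s ^ (-q) := by
    rcases le_total 1 s with h1s | hs1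
    · exact (Real.rpow_le_rpow_of_exponent_le h1s (by linarith)).trans
        (le_add_of_nonneg_left (by positivity))
    · exact (Real.rpow_le_rpow_of_exponent_ge hs hs1 (by linarith)).trans
        (le_add_of_nonneg_right (by positivity))
  rw [Real.norm_of_nonneg (by positivity), ← mul_assoc]
  gcongr

include h

lemma HasRegularTail.integrable_radialPrimitive [SFinite μ] : Integrable (radialPrimitive ψ) μ :=
  hψ.integrable_radialPrimitive h.limit_tail_lt_top
    (hα.integrableOn_mul_tail hψ hqα hαp hint)

include hq

variable [IsFiniteMeasure ρ]

omit hint in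
lemma HasRegularTail.exists_bound_mul_tail_le :
    ∃ C, ∀ᶠ t in atTop, ∀ s, 0 < s → B s * ρ.real {x | t * s < ‖x‖} ≤
      C * (B s * (s ^ (-p) + s ^ (-q))) * ρ.real {x | t < ‖x‖} := by
  obtain ⟨C, -, hpotter⟩ := h.exists_potter_bound hα hq hqα hαp
  refine ⟨C, ?_⟩
  filter_upwards [hpotter] with t ht s hs
  exact (mul_le_mul_of_nonneg_left (ht s hs) (hψ.bound_nonneg s)).trans_eq (by ring)

lemma HasRegularTail.eventually_integral_radialPrimitive :
    ∀ᶠ t in atTop, ∫ x, radialPrimitive ψ (t⁻¹ • x) ∂ρ =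
      ∫ s in Set.Ioi 0, tailIntegral ρ (ψ s) (t * s) := by
  obtain ⟨C, hbound⟩ := h.exists_bound_mul_tail_le hα hψ hq hqα hαp
  filter_upwards [hbound, eventually_gt_atTop 0] with t hb ht
  have hanti : Antitone fun s => ρ.real {x : E d | t * s < ‖x‖} := fun _ _ hrs =>
    antitone_measureReal_lt_norm (mul_le_mul_of_nonneg_left hrs ht.le)
  have hmeas : Measurable fun s => B s * ρ.real {x | t * s < ‖x‖} :=
    hψ.measurable_bound.mul hanti.measurable
  refine hψ.integral_radialPrimitive_inv_smul ht
    (((hint.const_mul C).mul_const (ρ.real {x | t < ‖x‖})).mono' hmeas.aestronglyMeasurable ?_)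
  filter_upwards [ae_restrict_mem measurableSet_Ioi] with s hs
  rw [Real.norm_of_nonneg (mul_nonneg (hψ.bound_nonneg s) measureReal_nonneg)]
  exact hb s hs

theorem HasRegularTail.tendsto_integral_radialPrimitive [SFinite μ] :
    Tendsto (fun t => (∫ x, radialPrimitive ψ (t⁻¹ • x) ∂ρ) / ρ.real {x | t < ‖x‖}) atTop
      (𝓝 ((∫ x, radialPrimitive ψ x ∂μ) / μ.real {x | 1 < ‖x‖})) := by
  obtain ⟨C, hbound⟩ := h.exists_bound_mul_tail_le hα hψ hq hqα hαp
  have hdominated : Tendsto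
      (fun t => ∫ s in Set.Ioi 0, tailIntegral ρ (ψ s) (t * s) / ρ.real {x | t < ‖x‖}) atTop
      (𝓝 (∫ s in Set.Ioi 0, tailIntegral μ (ψ s) s / μ.real {x | 1 < ‖x‖})) := by
    refine tendsto_integral_filter_of_dominated_convergence _ ?_ ?_ (hint.const_mul C) ?_
    · filter_upwards [eventually_gt_atTop 0] with t ht
      exact ((hψ.stronglyMeasurable_tailIntegral_mul ht).measurable.div_const _
        ).aestronglyMeasurable
    · filter_upwards [hbound, eventually_gt_atTop 0] with t hb ht
      filter_upwards [ae_restrict_mem measurableSet_Ioi] with s (hs : 0 < s)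
      rw [Real.norm_eq_abs, abs_div, abs_of_pos (h.tail_pos t), div_le_iff₀ (h.tail_pos t)]
      exact (abs_tailIntegral_le (measure_lt_top _ _) (by positivity) (hψ.abs_le s hs)).trans
        (hb s hs)
    · filter_upwards [ae_restrict_mem measurableSet_Ioi] with s hs
      exact h.tendsto_tailIntegral _ (hψ.continuous s) s hs
  rw [hψ.integral_radialPrimitive h.limit_tail_lt_top
    (hα.integrableOn_mul_tail hψ hqα hαp hint), ← integral_div]
  refine hdominated.congr' ?_
  filter_upwards [h.eventually_integral_radialPrimitive hα hψ hq hqα hαp hint] with t ht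
  rw [ht, integral_div]

end RegularTail

/-! ### The limit of the exponential moments -/

section Clip

variable {V : Type*} [NormedAddCommGroup V] [NormedSpace ℝ V]

/-- The radial retraction onto the closed unit ball. -/
noncomputable def clip (x : V) : V := min ‖x‖ 1 • (‖x‖⁻¹ • x)

lemma clip_of_norm_le {x : V} (hx : ‖x‖ ≤ 1) : clip x = x := by
  rcases eq_or_ne x 0 with rfl | hx0
  · simp [clip]
  · rw [clip, min_eq_left hx, smul_inv_smul₀ (norm_ne_zero_iff.2 hx0)]

lemma clip_of_one_le_norm {x : V} (hx : 1 ≤ ‖x‖) : clip x = ‖x‖⁻¹ • x := by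
  rw [clip, min_eq_right hx, one_smul]

lemma norm_clip (x : V) : ‖clip x‖ = min ‖x‖ 1 := by
  rcases le_total ‖x‖ 1 with hx | hx
  · rw [clip_of_norm_le hx, min_eq_left hx]
  · rw [clip_of_one_le_norm hx, min_eq_right hx, norm_direction le_rfl (one_pos.trans_le hx)]

lemma direction_clip (x : V) : ‖clip x‖⁻¹ • clip x = ‖x‖⁻¹ • x := by
  rcases eq_or_ne x 0 with rfl | hx
  · simp [clip]
  · have hnorm := norm_pos_iff.2 hx
    rw [clip, direction_smul (lt_min hnorm one_pos), direction_smul (inv_pos.2 hnorm)]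

lemma measurable_clip [MeasurableSpace V] [BorelSpace V] [SecondCountableTopology V] :
    Measurable (clip : V → V) := by
  unfold clip
  fun_prop

lemma radialPrimitive_indicator_Ioc (ψ : ℝ → V → ℝ) (x : V) :
    radialPrimitive (fun s u => (Set.Ioc 0 1).indicator (fun s => ψ s u) s) x =
      ∫ s in 0..‖clip x‖, ψ s (‖clip x‖⁻¹ • clip x) := by
  rw [radialPrimitive, ← integral_Ioc_eq_integral_Ioo, setIntegral_indicator measurableSet_Ioc,
    Set.Ioc_inter_Ioc, max_self, direction_clip, norm_clip,
    intervalIntegral.integral_of_le (le_min (norm_nonneg x) zero_le_one)]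

lemma radialPrimitive_indicator_Ioi (φ : V → ℝ) (x : V) :
    radialPrimitive (fun s u => (Set.Ioi 1).indicator (fun _ => φ u) s) x =
      (‖x‖ - min ‖x‖ 1) * φ (‖x‖⁻¹ • x) := by
  have hlength : max (‖x‖ - 1) 0 = ‖x‖ - min ‖x‖ 1 := by
    rw [← sub_self ‖x‖, max_sub_sub_left, min_comm]
  rw [radialPrimitive, ← integral_Ioc_eq_integral_Ioo, setIntegral_indicator measurableSet_Ioi,
    Set.Ioc_inter_Ioi, max_eq_right zero_le_one, setIntegral_const, Real.volume_real_Ioc,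
    hlength, smul_eq_mul]

end Clip

section LimitMeasure

variable {d : ℕ} {ρ μ : Measure (E d)} {α : ℝ}

lemma compl_closedBall_zero_one : (Metric.closedBall (0 : E d) 1)ᶜ = {x | 1 < ‖x‖} := by
  ext x
  simp

variable (h : HasRegularTail ρ μ) (hα : IsTailIndex μ α)

include h

lemma HasRegularTail.inv_tail_ne_top : (μ {x | 1 < ‖x‖})⁻¹ ≠ ⊤ :=
  ENNReal.inv_ne_top.2 fun hzero => h.limit_tail_pos.ne' (by simp [Measure.real, hzero])

include hα

/-- By homogeneity, `μ {x | r < ‖x‖}` is continuous in `r`. -/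
lemma HasRegularTail.one_le_norm_ae_eq : {x : E d | 1 ≤ ‖x‖} =ᵐ[μ] {x | 1 < ‖x‖} := by
  have hsub (r : ℝ) (hr : r < 1) : {x : E d | 1 ≤ ‖x‖} ⊆ {x | r < ‖x‖} :=
    fun x hx => hr.trans_le hx
  have hfin : μ {x : E d | 1 ≤ ‖x‖} < ⊤ :=
    (measure_mono (hsub _ one_half_lt_one)).trans_lt (h.limit_tail_lt_top _ one_half_pos)
  have hcont : Tendsto (fun r => μ.real {x : E d | r < ‖x‖}) (𝓝 1)
      (𝓝 (μ.real {x : E d | 1 < ‖x‖})) := by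
    simp only [← tailIntegral_one]
    exact hα.continuousAt_tailIntegral continuous_const one_pos
  have hle : {x : E d | 1 < ‖x‖} ⊆ {x | 1 ≤ ‖x‖} := fun x (hx : 1 < ‖x‖) => hx.le
  refine (ae_eq_of_subset_of_measure_ge hle ?_
    (measurableSet_lt_norm 1).nullMeasurableSet hfin.ne).symm
  rw [← ENNReal.toReal_le_toReal hfin.ne (h.limit_tail_lt_top 1 one_pos).ne]
  refine ge_of_tendsto (hcont.mono_left (nhdsWithin_le_nhds (s := Set.Iio 1))) ?_
  filter_upwards [self_mem_nhdsWithin, (lt_mem_nhds one_pos).filter_mono nhdsWithin_le_nhds]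
    with r hr hr0
  exact measureReal_mono (hsub r hr) (h.limit_tail_lt_top r hr0).ne

lemma HasRegularTail.spectral_eq :
    spectral μ = (μ {x | 1 < ‖x‖})⁻¹ • (μ.restrict {x | 1 < ‖x‖}).map fun x => ‖x‖⁻¹ • x := by
  rw [spectral, Measure.restrict_congr_set (h.one_le_norm_ae_eq hα), compl_closedBall_zero_one]

omit h hα in
lemma ae_spectral_norm_eq_one (μ : Measure (E d)) : ∀ᵐ x ∂(spectral μ), ‖x‖ = 1 := by
  refine Measure.ae_smul_measure ?_ _
  rw [ae_map_iff (by fun_prop) (measurableSet_eq_fun measurable_norm measurable_const),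
    ae_restrict_iff' (measurableSet_le measurable_const measurable_norm)]
  exact Eventually.of_forall fun x (hx : 1 ≤ ‖x‖) => norm_direction le_rfl (one_pos.trans_le hx)

lemma HasRegularTail.nu_eq : nu μ = (μ {x | 1 < ‖x‖})⁻¹ • μ.map clip := by
  have hball : (μ.restrict (Metric.closedBall 0 1)).map clip =
      μ.restrict (Metric.closedBall 0 1) := by
    rw [Measure.map_congr (g := id) ?_, Measure.map_id]
    filter_upwards [ae_restrict_mem measurableSet_closedBall] with x hx
    exact clip_of_norm_le (mem_closedBall_zero_iff.1 hx)
  have hcompl : (μ.restrict {x | 1 < ‖x‖}).map clip =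
      (μ.restrict {x | 1 < ‖x‖}).map fun x => ‖x‖⁻¹ • x := by
    refine Measure.map_congr ?_
    filter_upwards [ae_restrict_mem (measurableSet_lt_norm 1)] with x hx
    exact clip_of_one_le_norm (le_of_lt hx)
  have hsphere : (spectral μ).restrict (Metric.sphere 0 1) = spectral μ :=
    Measure.restrict_eq_self_of_ae_mem
      ((ae_spectral_norm_eq_one μ).mono fun x hx => mem_sphere_zero_iff_norm.2 hx)
  rw [nu, hsphere, h.spectral_eq hα, compl_closedBall_zero_one, ← hcompl, ← hball, ← smul_add,
    ← Measure.map_add _ _ measurable_clip, ← compl_closedBall_zero_one,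
    Measure.restrict_add_restrict_compl measurableSet_closedBall]

lemma HasRegularTail.integral_nu {F : E d → ℝ} (hF : Measurable F) :
    ∫ x, F x ∂(nu μ) = (∫ x, F (clip x) ∂μ) / μ.real {x | 1 < ‖x‖} := by
  rw [h.nu_eq hα, integral_smul_measure, integral_map measurable_clip.aemeasurable
    hF.aestronglyMeasurable, ENNReal.toReal_inv, smul_eq_mul, inv_mul_eq_div]
  rfl

lemma HasRegularTail.integrable_nu {F : E d → ℝ} (hF : Measurable F)
    (hint : Integrable (fun x => F (clip x)) μ) : Integrable F (nu μ) := by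
  rw [h.nu_eq hα]
  exact ((integrable_map_measure hF.aestronglyMeasurable measurable_clip.aemeasurable).2 hint
    ).smul_measure h.inv_tail_ne_top

lemma HasRegularTail.ae_nu_norm_le_one : ∀ᵐ x ∂(nu μ), ‖x‖ ≤ 1 := by
  rw [h.nu_eq hα]
  refine Measure.ae_smul_measure ?_ _
  rw [ae_map_iff measurable_clip.aemeasurable (measurableSet_le measurable_norm measurable_const)]
  exact Eventually.of_forall fun x => (norm_clip x).trans_le (min_le_right _ _)

lemma HasRegularTail.integrable_spectral {φ : E d → ℝ} (hφ : Continuous φ) :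
    Integrable φ (spectral μ) := by
  rw [h.spectral_eq hα]
  exact ((integrable_map_measure hφ.aestronglyMeasurable (by fun_prop)).2
    (integrableOn_direction (h.limit_tail_lt_top 1 one_pos) hφ zero_le_one)).smul_measure
    h.inv_tail_ne_top

lemma HasRegularTail.integral_spectral {φ : E d → ℝ} (hφ : Continuous φ) :
    ∫ x, φ x ∂(spectral μ) = tailIntegral μ φ 1 / μ.real {x | 1 < ‖x‖} := by
  rw [h.spectral_eq hα, integral_smul_measure, integral_map (by fun_prop)
    hφ.aestronglyMeasurable, ENNReal.toReal_inv, smul_eq_mul, inv_mul_eq_div]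
  rfl

end LimitMeasure

section Clipped

variable {d : ℕ} {ρ μ : Measure (E d)} {α : ℝ} {b : ℕ}

lemma integrableOn_inner_bound (K : ℝ) {p q : ℝ} (hqp : q < p) (hpb : p < b + 1) :
    IntegrableOn (fun s : ℝ => (Set.Ioc 0 1).indicator (fun s => K * s ^ b) s *
      (s ^ (-p) + s ^ (-q))) (Set.Ioi 0) := by
  have hrpow {r : ℝ} (hr : r < b + 1) :
      IntegrableOn (fun s : ℝ => s ^ (b - r)) (Set.Ioc 0 1) :=
    (intervalIntegrable_iff_integrableOn_Ioc_of_le zero_le_one).1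
      (intervalIntegral.intervalIntegrable_rpow' (by linarith))
  have hsum := ((hrpow hpb).add (hrpow (hqp.trans hpb))).const_mul K
  have hindicator : (fun s : ℝ => (Set.Ioc 0 1).indicator (fun s => K * s ^ b) s *
      (s ^ (-p) + s ^ (-q))) =
      (Set.Ioc 0 1).indicator fun s => K * s ^ b * (s ^ (-p) + s ^ (-q)) :=
    funext fun _ =>
      (Set.indicator_mul_left _ (fun s => K * s ^ b) fun s => s ^ (-p) + s ^ (-q)).symm
  rw [hindicator]
  refine ((integrable_indicator_iff measurableSet_Ioc).2 ?_).integrableOn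
  refine IntegrableOn.congr_fun hsum (fun s hs => ?_) measurableSet_Ioc
  simp only [Pi.add_apply, sub_eq_add_neg, Real.rpow_add hs.1, Real.rpow_natCast]
  ring

variable {ψ : ℝ → E d → ℝ} {K : ℝ}

lemma isRadialDensity_indicator_Ioc (hψ : Continuous (Function.uncurry ψ)) (hK0 : 0 ≤ K)
    (hK : ∀ s, 0 < s → s ≤ 1 → ∀ u, ‖u‖ = 1 → |ψ s u| ≤ K * s ^ b) :
    IsRadialDensity (fun s u => (Set.Ioc 0 1).indicator (fun s => ψ s u) s)
      ((Set.Ioc 0 1).indicator fun s => K * s ^ b) where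
  measurable := hψ.measurable.indicator (measurable_fst measurableSet_Ioc)
  continuous s := by
    by_cases hs : s ∈ Set.Ioc (0 : ℝ) 1
    · simp only [Set.indicator_of_mem hs]
      exact hψ.comp (by fun_prop : Continuous fun u => (s, u))
    · simpa only [Set.indicator_of_notMem hs] using continuous_const
  measurable_bound := Measurable.indicator (by fun_prop) measurableSet_Ioc
  bound_nonneg := Set.indicator_nonneg fun s hs =>
    mul_nonneg hK0 (pow_nonneg (le_of_lt hs.1) _)
  abs_le s hs u hu := by
    by_cases hs1 : s ∈ Set.Ioc (0 : ℝ) 1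
    · simpa only [Set.indicator_of_mem hs1] using hK s hs hs1.2 u hu
    · simp [Set.indicator_of_notMem hs1]

variable (h : HasRegularTail ρ μ) (hα : IsTailIndex μ α) (hαb : α < b + 1) [SFinite μ]
  (hψ : Continuous (Function.uncurry ψ)) (hK0 : 0 ≤ K)
  (hK : ∀ s, 0 < s → s ≤ 1 → ∀ u, ‖u‖ = 1 → |ψ s u| ≤ K * s ^ b) {F : E d → ℝ}
  (hF : ∀ x, F x = ∫ s in 0..‖x‖, ψ s (‖x‖⁻¹ • x))

include h hα hαb hψ hK0 hK hF

lemma HasRegularTail.integrable_comp_clip : Integrable (fun x => F (clip x)) μ := by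
  obtain ⟨p, hαp, hpb⟩ := exists_between hαb
  have hdensity := isRadialDensity_indicator_Ioc hψ hK0 hK
  simp only [hF, ← radialPrimitive_indicator_Ioc]
  exact h.integrable_radialPrimitive hα hdensity (half_lt_self hα.1) hαp
    (integrableOn_inner_bound K (by linarith [hα.1]) hpb)

theorem HasRegularTail.tendsto_integral_comp_clip (hFm : Measurable F) [IsFiniteMeasure ρ] :
    Tendsto (fun t => (∫ x, F (clip (t⁻¹ • x)) ∂ρ) / ρ.real {x | t < ‖x‖}) atTop
      (𝓝 (∫ x, F x ∂(nu μ))) := by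
  obtain ⟨p, hαp, hpb⟩ := exists_between hαb
  have hdensity := isRadialDensity_indicator_Ioc hψ hK0 hK
  rw [h.integral_nu hα hFm]
  simp only [hF, ← radialPrimitive_indicator_Ioc]
  exact h.tendsto_integral_radialPrimitive hα hdensity (half_pos hα.1) (half_lt_self hα.1) hαp
    (integrableOn_inner_bound K (by linarith [hα.1]) hpb)

end Clipped

section CompensatedExponential

/-- The order of the compensation of the exponential in `Λ`. -/
noncomputable def compOrder (α : ℝ) : ℕ := if α < 1 then 0 else 1

lemma compOrder_le_one (α : ℝ) : compOrder α ≤ 1 := by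
  unfold compOrder
  split_ifs <;> norm_num

lemma lt_compOrder_add_one {α : ℝ} (hα : α < 2) : α < compOrder α + 1 := by
  unfold compOrder
  split_ifs <;> norm_num <;> linarith

lemma abs_exp_sub_natCast_le {b : ℕ} (hb : b ≤ 1) (y : ℝ) :
    |Real.exp y - b| ≤ |y| ^ b * Real.exp |y| := by
  have hexp := Complex.norm_exp_sub_sum_le_norm_mul_exp y b
  rw [← Complex.ofReal_exp, Complex.norm_real, Real.norm_eq_abs] at hexp
  have hsum : ∑ m ∈ Finset.range b, (y : ℂ) ^ m / m.factorial = (b : ℝ) := by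
    interval_cases b <;> simp
  rwa [hsum, ← Complex.ofReal_sub, Complex.norm_real] at hexp

variable {d : ℕ} {α : ℝ}

lemma integrand_eq (α : ℝ) (l x : E d) :
    integrand α l x = Real.exp ⟪l, x⟫ - 1 - compOrder α * ⟪l, x⟫ := by
  unfold integrand compOrder
  split_ifs <;> simp

lemma continuous_integrand (α : ℝ) (l : E d) : Continuous (integrand α l) := by
  simp only [funext (integrand_eq α l)]
  fun_prop

/-- The derivative of the compensated exponential along the ray of direction `u`. -/
noncomputable def integrandDensity (α : ℝ) (l : E d) (s : ℝ) (u : E d) : ℝ :=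
  ⟪l, u⟫ * (Real.exp (s * ⟪l, u⟫) - compOrder α)

lemma continuous_integrandDensity (α : ℝ) (l : E d) :
    Continuous (Function.uncurry (integrandDensity α l)) := by
  unfold integrandDensity Function.uncurry
  fun_prop

lemma abs_integrandDensity_le (α : ℝ) (l : E d) {s : ℝ} (hs : 0 < s) (hs1 : s ≤ 1) {u : E d}
    (hu : ‖u‖ = 1) :
    |integrandDensity α l s u| ≤ ‖l‖ * (‖l‖ ^ compOrder α * Real.exp ‖l‖) * s ^ compOrder α := by
  have hlu : |⟪l, u⟫| ≤ ‖l‖ := by simpa [hu] using abs_real_inner_le_norm l u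
  have hslu : |s * ⟪l, u⟫| ≤ s * ‖l‖ := by
    rw [abs_mul, abs_of_pos hs]
    gcongr
  calc |integrandDensity α l s u| = |⟪l, u⟫| * |Real.exp (s * ⟪l, u⟫) - compOrder α| := abs_mul _ _
    _ ≤ ‖l‖ * ((s * ‖l‖) ^ compOrder α * Real.exp ‖l‖) := by
      gcongr
      refine (abs_exp_sub_natCast_le (compOrder_le_one α) _).trans ?_
      gcongr
      exact hslu.trans (mul_le_of_le_one_left (norm_nonneg l) hs1)
    _ = _ := by rw [mul_pow]; ring

lemma integrand_eq_intervalIntegral (α : ℝ) (l x : E d) :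
    integrand α l x = ∫ s in 0..‖x‖, integrandDensity α l s (‖x‖⁻¹ • x) := by
  set a := ⟪l, ‖x‖⁻¹ • x⟫ with ha
  have hax : ‖x‖ * a = ⟪l, x⟫ := by
    rcases eq_or_ne x 0 with rfl | hx
    · simp
    · rw [ha, ← real_inner_smul_right, smul_inv_smul₀ (norm_ne_zero_iff.2 hx)]
  have hderiv (s : ℝ) : HasDerivAt (fun s => Real.exp (s * a) - 1 - compOrder α * (s * a))
      (integrandDensity α l s (‖x‖⁻¹ • x)) s := by
    have hlin := (hasDerivAt_id s).mul_const a
    refine ((hlin.exp.sub_const 1).sub (hlin.const_mul (compOrder α : ℝ))).congr_deriv ?_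
    simp only [integrandDensity, id, ← ha]
    ring
  have hcont : Continuous fun s => integrandDensity α l s (‖x‖⁻¹ • x) :=
    (continuous_integrandDensity α l).comp (by fun_prop : Continuous fun s => (s, ‖x‖⁻¹ • x))
  rw [intervalIntegral.integral_eq_sub_of_hasDerivAt (fun s _ => hderiv s)
    (hcont.intervalIntegrable _ _), hax, integrand_eq]
  simp

lemma norm_pow_succ_eq_intervalIntegral (b : ℕ) (x : E d) :
    ‖x‖ ^ (b + 1) = ∫ s in 0..‖x‖, ((b : ℝ) + 1) * s ^ b := by
  rw [intervalIntegral.integral_const_mul, integral_pow]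
  field_simp
  simp

variable {ρ μ : Measure (E d)} (h : HasRegularTail ρ μ) (hα : IsTailIndex μ α) (hα2 : α < 2)
  [SFinite μ]

include h hα hα2

lemma HasRegularTail.integrable_integrand (l : E d) : Integrable (integrand α l) (nu μ) :=
  h.integrable_nu hα (continuous_integrand α l).measurable <|
    h.integrable_comp_clip hα (lt_compOrder_add_one hα2) (continuous_integrandDensity α l)
      (by positivity) (fun _ hs hs1 _ hu => abs_integrandDensity_le α l hs hs1 hu)
      (integrand_eq_intervalIntegral α l)

lemma HasRegularTail.tendsto_integral_integrand_clip [IsFiniteMeasure ρ] (l : E d) :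
    Tendsto (fun t => (∫ x, integrand α l (clip (t⁻¹ • x)) ∂ρ) / ρ.real {x | t < ‖x‖}) atTop
      (𝓝 (∫ x, integrand α l x ∂(nu μ))) :=
  h.tendsto_integral_comp_clip hα (lt_compOrder_add_one hα2) (continuous_integrandDensity α l)
    (by positivity) (fun _ hs hs1 _ hu => abs_integrandDensity_le α l hs hs1 hu)
    (integrand_eq_intervalIntegral α l) (continuous_integrand α l).measurable

lemma HasRegularTail.integrable_norm_pow_nu :
    Integrable (fun x => ‖x‖ ^ (compOrder α + 1)) (nu μ) := by
  refine h.integrable_nu hα (by fun_prop) <| h.integrable_comp_clip hα (lt_compOrder_add_one hα2)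
    (ψ := fun s _ => ((compOrder α : ℝ) + 1) * s ^ compOrder α)
    (by unfold Function.uncurry; fun_prop) (K := (compOrder α : ℝ) + 1) (by positivity)
    (fun s hs _ _ _ => by rw [abs_of_nonneg (by positivity)])
    (norm_pow_succ_eq_intervalIntegral _)

end CompensatedExponential

section Drift

/-- The centering hypotheses on the law `ρ` of `H`: symmetry for `α = 1`, and zero mean for
`1 < α`. -/
structure IsCentered {d : ℕ} (ρ : Measure (E d)) (α : ℝ) : Prop where
  map_neg : α = 1 → ρ.map (fun x => -x) = ρ
  integrable : 1 < α → Integrable (fun x => x) ρ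
  integral_eq_zero : 1 < α → ∫ x, x ∂ρ = 0

variable {d : ℕ} {ρ μ : Measure (E d)} {α : ℝ}

lemma clip_neg (x : E d) : clip (-x) = -clip x := by
  simp [clip]

lemma integrable_comp_clip_smul [IsFiniteMeasure ρ] {F : E d → ℝ} (hF : Continuous F) (t : ℝ) :
    Integrable (fun x => F (clip (t⁻¹ • x))) ρ := by
  obtain ⟨K, hK⟩ := (isCompact_closedBall (0 : E d) 1).exists_bound_of_continuousOn hF.continuousOn
  refine Integrable.of_bound
    (hF.measurable.comp (measurable_clip.comp (by fun_prop))).aestronglyMeasurable K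
    (Eventually.of_forall fun x => hK _ ?_)
  rw [mem_closedBall_zero_iff, norm_clip]
  exact min_le_right _ _

lemma IsCentered.integral_inner_clip_of_eq_one (hρ : IsCentered ρ α) (hα1 : α = 1) (l : E d)
    (t : ℝ) : ∫ x, ⟪l, clip (t⁻¹ • x)⟫ ∂ρ = 0 := by
  have hodd : ∫ x, ⟪l, clip (t⁻¹ • x)⟫ ∂ρ = -∫ x, ⟪l, clip (t⁻¹ • x)⟫ ∂ρ := by
    conv_lhs => rw [← hρ.map_neg hα1]
    have hmeas : Measurable fun x : E d => ⟪l, clip (t⁻¹ • x)⟫ :=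
      measurable_const.inner (measurable_clip.comp (by fun_prop))
    rw [integral_map (by fun_prop) hmeas.aestronglyMeasurable, ← integral_neg]
    simp only [smul_neg, clip_neg, inner_neg_right]
  linarith

lemma isRadialDensity_indicator_Ioi (l : E d) :
    IsRadialDensity (fun s u => (Set.Ioi 1).indicator (fun _ => ⟪l, u⟫) s)
      ((Set.Ioi 1).indicator fun _ => ‖l‖) where
  measurable := by
    have hinner : Measurable fun z : ℝ × E d => ⟪l, z.2⟫ := by fun_prop
    exact hinner.indicator (measurable_fst measurableSet_Ioi)
  continuous s := by
    by_cases hs : s ∈ Set.Ioi (1 : ℝ)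
    · simp only [Set.indicator_of_mem hs]
      fun_prop
    · simpa only [Set.indicator_of_notMem hs] using continuous_const
  measurable_bound := measurable_const.indicator measurableSet_Ioi
  bound_nonneg := Set.indicator_nonneg fun _ _ => norm_nonneg l
  abs_le s _ u hu := by
    by_cases hs : s ∈ Set.Ioi (1 : ℝ)
    · simpa [Set.indicator_of_mem hs, hu] using abs_real_inner_le_norm l u
    · simp [Set.indicator_of_notMem hs]

lemma integrableOn_outer_bound (K : ℝ) {p q : ℝ} (hq : 1 < q) (hqp : q < p) :
    IntegrableOn (fun s : ℝ => (Set.Ioi 1).indicator (fun _ => K) s * (s ^ (-p) + s ^ (-q)))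
      (Set.Ioi 0) := by
  have hsum := ((integrableOn_Ioi_rpow_of_lt (neg_lt_neg (hq.trans hqp)) one_pos).add
    (integrableOn_Ioi_rpow_of_lt (neg_lt_neg hq) one_pos)).const_mul K
  have hindicator : (fun s : ℝ => (Set.Ioi 1).indicator (fun _ => K) s * (s ^ (-p) + s ^ (-q))) =
      (Set.Ioi 1).indicator fun s => K * (s ^ (-p) + s ^ (-q)) :=
    funext fun _ => (Set.indicator_mul_left _ (fun _ => K) fun s => s ^ (-p) + s ^ (-q)).symm
  rw [hindicator]
  exact ((integrable_indicator_iff measurableSet_Ioi).2 hsum).integrableOn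

lemma radialPrimitive_indicator_Ioi_inner (l x : E d) :
    radialPrimitive (fun s u => (Set.Ioi 1).indicator (fun _ => ⟪l, u⟫) s) x =
      ⟪l, x⟫ - ⟪l, clip x⟫ := by
  rcases eq_or_ne x 0 with rfl | hx
  · simp [radialPrimitive_indicator_Ioi, clip]
  · rw [radialPrimitive_indicator_Ioi, clip, real_inner_smul_right l _ (min _ _), sub_mul,
      ← real_inner_smul_right _ _ ‖x‖, smul_inv_smul₀ (norm_ne_zero_iff.2 hx)]

lemma IsTailIndex.integral_tailIntegral_indicator_Ioi (hα : IsTailIndex μ α) (hα1 : 1 < α)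
    {φ : E d → ℝ} (hφ : Continuous φ) :
    ∫ s in Set.Ioi 0, tailIntegral μ (fun u => (Set.Ioi 1).indicator (fun _ => φ u) s) s =
      1 / (α - 1) * tailIntegral μ φ 1 := by
  have hindicator : (fun s => tailIntegral μ (fun u => (Set.Ioi 1).indicator (fun _ => φ u) s) s) =
      (Set.Ioi 1).indicator (tailIntegral μ φ) := by
    funext s
    by_cases hs : s ∈ Set.Ioi (1 : ℝ)
    · simp only [Set.indicator_of_mem hs]
    · simp [Set.indicator_of_notMem hs, tailIntegral]
  have hpower : Set.EqOn (tailIntegral μ φ) (fun s => s ^ (-α) * tailIntegral μ φ 1) (Set.Ioi 1) :=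
    fun s hs => hα.tailIntegral_eq hφ (one_pos.trans hs)
  rw [hindicator, setIntegral_indicator measurableSet_Ioi, Set.Ioi_inter_Ioi,
    max_eq_right zero_le_one, setIntegral_congr_fun measurableSet_Ioi hpower, integral_mul_const,
    integral_Ioi_rpow_of_lt (neg_lt_neg hα1) one_pos, Real.one_rpow, neg_add_eq_sub,
    ← neg_sub α 1, neg_div_neg_eq]

variable (h : HasRegularTail ρ μ) (hα : IsTailIndex μ α) (hρ : IsCentered ρ α)
  [IsFiniteMeasure ρ] [SFinite μ]

include h hα hρ

/-- As the mean vanishes, the clipped vector has the mean of minus the part that is cut off. -/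
lemma HasRegularTail.tendsto_integral_inner_clip (hα1 : 1 < α) (l : E d) :
    Tendsto (fun t => (∫ x, ⟪l, clip (t⁻¹ • x)⟫ ∂ρ) / ρ.real {x | t < ‖x‖}) atTop
      (𝓝 (-(1 / (α - 1) * ∫ s, ⟪l, s⟫ ∂(spectral μ)))) := by
  obtain ⟨q, hq, hqα⟩ := exists_between hα1
  have hbound := integrableOn_outer_bound ‖l‖ hq (hqα.trans (lt_add_one α))
  have hdensity := isRadialDensity_indicator_Ioi l
  have houter := h.tendsto_integral_radialPrimitive hα hdensity (one_pos.trans hq) hqα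
    (lt_add_one α) hbound
  have hlimit : (∫ x, radialPrimitive (fun s u => (Set.Ioi 1).indicator (fun _ => ⟪l, u⟫) s) x ∂μ) /
      μ.real {x | 1 < ‖x‖} = 1 / (α - 1) * ∫ s, ⟪l, s⟫ ∂(spectral μ) := by
    rw [hdensity.integral_radialPrimitive h.limit_tail_lt_top
      (hα.integrableOn_mul_tail hdensity hqα (lt_add_one α) hbound),
      hα.integral_tailIntegral_indicator_Ioi hα1 (by fun_prop),
      h.integral_spectral hα (by fun_prop), mul_div_assoc]
  rw [hlimit] at houter
  refine houter.neg.congr fun t => ?_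
  have hmean : ∫ x, ⟪l, t⁻¹ • x⟫ ∂ρ = 0 := by
    simp only [real_inner_smul_right]
    rw [integral_const_mul, integral_inner (hρ.integrable hα1), hρ.integral_eq_zero hα1,
      inner_zero_right, mul_zero]
  have hint : Integrable (fun x => ⟪l, t⁻¹ • x⟫) ρ :=
    ((hρ.integrable hα1).smul t⁻¹).const_inner l
  simp only [radialPrimitive_indicator_Ioi_inner]
  rw [integral_sub hint (integrable_comp_clip_smul (by fun_prop) t), hmean, zero_sub, neg_div,
    neg_neg]

theorem HasRegularTail.tendsto_integral_exp_clip (hα2 : α < 2) (l : E d) :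
    Tendsto (fun t => (∫ x, (Real.exp ⟪l, clip (t⁻¹ • x)⟫ - 1) ∂ρ) / ρ.real {x | t < ‖x‖}) atTop
      (𝓝 (Lam μ α l)) := by
  have hdrift : Tendsto (fun t => compOrder α *
      ((∫ x, ⟪l, clip (t⁻¹ • x)⟫ ∂ρ) / ρ.real {x | t < ‖x‖})) atTop
      (𝓝 (Lam μ α l - ∫ x, integrand α l x ∂(nu μ))) := by
    rcases lt_trichotomy α 1 with hα1 | hα1 | hα1
    · simp [compOrder, Lam, hα1, hα1.le]
    · simp [hρ.integral_inner_clip_of_eq_one hα1, Lam, hα1.le]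
    · simpa [compOrder, Lam, hα1.not_gt, hα1.not_ge] using
        h.tendsto_integral_inner_clip hα hρ hα1 l
  have hsum := (h.tendsto_integral_integrand_clip hα hα2 l).add hdrift
  rw [add_sub_cancel] at hsum
  refine hsum.congr fun t => ?_
  have hsplit (x : E d) : Real.exp ⟪l, clip (t⁻¹ • x)⟫ - 1 =
      integrand α l (clip (t⁻¹ • x)) + compOrder α * ⟪l, clip (t⁻¹ • x)⟫ := by
    rw [integrand_eq, sub_add_cancel]
  simp only [hsplit]
  rw [integral_add (integrable_comp_clip_smul (continuous_integrand α l) t)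
    ((integrable_comp_clip_smul (by fun_prop : Continuous fun x => ⟪l, x⟫) t).const_mul _),
    integral_const_mul, add_div, mul_div_assoc]

end Drift

section Differentiability

variable {d : ℕ} {ρ μ : Measure (E d)} {α : ℝ}

lemma hasFDerivAt_integrand (α : ℝ) (l x : E d) :
    HasFDerivAt (fun l => integrand α l x)
      ((Real.exp ⟪l, x⟫ - compOrder α) • innerSL ℝ x) l := by
  have hinner : HasFDerivAt (fun l : E d => ⟪l, x⟫) (innerSL ℝ x) l :=
    (innerSL ℝ x).hasFDerivAt.congr_of_eventuallyEq
      (Eventually.of_forall fun l => real_inner_comm x l)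
  simp only [integrand_eq, sub_smul]
  exact (hinner.exp.sub_const 1).sub (hinner.const_mul _)

lemma norm_fderiv_integrand_le (α : ℝ) {l x : E d} (hx : ‖x‖ ≤ 1) {R : ℝ} (hl : ‖l‖ ≤ R) :
    ‖(Real.exp ⟪l, x⟫ - compOrder α) • innerSL ℝ x‖ ≤
      R ^ compOrder α * Real.exp R * ‖x‖ ^ (compOrder α + 1) := by
  have hinner : |⟪l, x⟫| ≤ R * ‖x‖ := (abs_real_inner_le_norm l x).trans (by gcongr)
  have hR : 0 ≤ R := (norm_nonneg l).trans hl
  calc ‖(Real.exp ⟪l, x⟫ - compOrder α) • innerSL ℝ x‖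
      = |Real.exp ⟪l, x⟫ - compOrder α| * ‖x‖ := by
        rw [norm_smul, innerSL_apply_norm, Real.norm_eq_abs]
    _ ≤ |⟪l, x⟫| ^ compOrder α * Real.exp |⟪l, x⟫| * ‖x‖ := by
        gcongr
        exact abs_exp_sub_natCast_le (compOrder_le_one α) _
    _ ≤ (R * ‖x‖) ^ compOrder α * Real.exp R * ‖x‖ := by
        gcongr
        exact hinner.trans (mul_le_of_le_one_right hR hx)
    _ = _ := by rw [mul_pow, pow_succ]; ring

variable (h : HasRegularTail ρ μ) (hα : IsTailIndex μ α)

include h hα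

lemma HasRegularTail.differentiable_integral_integrand [SFinite μ] (hα2 : α < 2) :
    Differentiable ℝ fun l => ∫ x, integrand α l x ∂(nu μ) := by
  intro l₀
  refine (hasFDerivAt_integral_of_dominated_of_fderiv_le (F := integrand α)
    (F' := fun l x => (Real.exp ⟪l, x⟫ - compOrder α) • innerSL ℝ x)
    (bound := fun x => (‖l₀‖ + 1) ^ compOrder α * Real.exp (‖l₀‖ + 1) * ‖x‖ ^ (compOrder α + 1))
    (Metric.ball_mem_nhds l₀ one_pos)
    (Eventually.of_forall fun l => (continuous_integrand α l).aestronglyMeasurable)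
    (h.integrable_integrand hα hα2 l₀) ?_ ?_
    ((h.integrable_norm_pow_nu hα hα2).const_mul _)
    (Eventually.of_forall fun x l _ => hasFDerivAt_integrand α l x)).differentiableAt
  · have : Continuous fun x : E d => innerSL ℝ x := (innerSL ℝ).continuous
    exact Continuous.aestronglyMeasurable (by fun_prop)
  · filter_upwards [h.ae_nu_norm_le_one hα] with x hx l hl
    refine norm_fderiv_integrand_le α hx ?_
    linarith [norm_sub_norm_le l l₀, mem_ball_iff_norm.1 hl]

lemma HasRegularTail.differentiable_integral_inner_spectral :
    Differentiable ℝ fun l : E d => ∫ s, ⟪l, s⟫ ∂(spectral μ) := by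
  have hint : Integrable (fun s => s) (spectral μ) :=
    (integrable_norm_iff aestronglyMeasurable_id).1 (h.integrable_spectral hα continuous_norm)
  simp only [integral_inner hint]
  exact differentiable_id.inner ℝ (differentiable_const _)

theorem HasRegularTail.differentiable_Lam [SFinite μ] (hα2 : α < 2) :
    Differentiable ℝ (Lam μ α) := by
  have hnu := h.differentiable_integral_integrand hα hα2
  unfold Lam
  split_ifs
  · exact hnu
  · exact hnu.sub ((h.differentiable_integral_inner_spectral hα).const_mul _)

end Differentiability

section ExponentialMoment

variable {d : ℕ} {ρ μ : Measure (E d)} {τ : Measure ℝ} {α : ℝ}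

lemma measurable_truncate {Ω : Type*} [MeasurableSpace Ω] {h : Ω → E d} {ℓ : Ω → ℝ}
    (hh : Measurable h) (hℓ : Measurable ℓ) (t : ℝ) :
    Measurable fun ω => truncate t (h ω) (ℓ ω) := by
  unfold truncate
  exact Measurable.ite (measurableSet_le hh.norm measurable_const) hh (by fun_prop)

lemma abs_exp_sub_one_le_exp_abs_sub_one (x : ℝ) : |Real.exp x - 1| ≤ Real.exp |x| - 1 := by
  simpa [← Complex.ofReal_exp, ← Complex.ofReal_one, ← Complex.ofReal_sub] using
    Complex.norm_exp_sub_sum_le_exp_norm_sub_sum x 1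

lemma abs_exp_inner_truncate_sub_le (l h : E d) {t ℓ : ℝ} (ht : 0 < t) (hℓ : 0 ≤ ℓ) :
    |Real.exp (t⁻¹ * ⟪l, truncate t h ℓ⟫) - Real.exp ⟪l, clip (t⁻¹ • h)⟫| ≤
      {x | t < ‖x‖}.indicator (fun _ => Real.exp ‖l‖) h * (Real.exp (‖l‖ / t * ℓ) - 1) := by
  have hnorm : ‖t⁻¹ • h‖ = ‖h‖ / t := by
    rw [norm_smul, norm_inv, Real.norm_of_nonneg ht.le, inv_mul_eq_div]
  rcases le_or_gt ‖h‖ t with hle | hlt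
  · have hmem : h ∉ {x : E d | t < ‖x‖} := not_lt.2 hle
    rw [Set.indicator_of_notMem hmem, truncate, if_pos hle,
      clip_of_norm_le (hnorm.trans_le ((div_le_one ht).2 hle)), real_inner_smul_right]
    simp
  · set v := ⟪l, ‖h‖⁻¹ • h⟫
    have hv : |v| ≤ ‖l‖ := by
      simpa [norm_direction ht.le hlt] using abs_real_inner_le_norm l (‖h‖⁻¹ • h)
    have hexponent : t⁻¹ * ((t + ℓ) * v) = v + v / t * ℓ := by
      field_simp
    have hmem : h ∈ {x : E d | t < ‖x‖} := hlt
    rw [Set.indicator_of_mem hmem, truncate, if_neg hlt.not_ge, real_inner_smul_right,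
      clip_of_one_le_norm (((one_le_div ht).2 hlt.le).trans_eq hnorm.symm),
      direction_smul (inv_pos.2 ht), hexponent, Real.exp_add, ← mul_sub_one, abs_mul, Real.abs_exp]
    gcongr
    · exact (le_abs_self v).trans hv
    · refine (abs_exp_sub_one_le_exp_abs_sub_one _).trans ?_
      rw [abs_mul, abs_div, abs_of_pos ht, abs_of_nonneg hℓ]
      gcongr

lemma integrable_exp_inner_clip_smul [IsFiniteMeasure ρ] (l : E d) (t : ℝ) :
    Integrable (fun x => Real.exp ⟪l, clip (t⁻¹ • x)⟫) ρ :=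
  integrable_comp_clip_smul (F := fun x => Real.exp ⟪l, x⟫) (by fun_prop) t

variable (l : E d) {t : ℝ} (ht : 0 < t) [IsFiniteMeasure ρ]

lemma integrable_overshoot_bound [IsFiniteMeasure τ] (hτt : ‖l‖ / t ∈ integrableExpSet id τ) :
    Integrable (fun z : E d × ℝ => {x | t < ‖x‖}.indicator (fun _ => Real.exp ‖l‖) z.1 *
      (Real.exp (‖l‖ / t * z.2) - 1)) (ρ.prod τ) :=
  ((integrable_const _).indicator (measurableSet_lt_norm t)).mul_prod
    (Integrable.sub hτt (integrable_const 1))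

variable [IsProbabilityMeasure τ] (hτ0 : ∀ᵐ ℓ ∂τ, 0 ≤ ℓ)
  (hτt : ‖l‖ / t ∈ integrableExpSet id τ)

include ht hτ0 hτt

lemma integrable_exp_inner_truncate_sub :
    Integrable (fun z : E d × ℝ => Real.exp (t⁻¹ * ⟪l, truncate t z.1 z.2⟫) -
      Real.exp ⟪l, clip (t⁻¹ • z.1)⟫) (ρ.prod τ) := by
  refine (integrable_overshoot_bound l hτt).mono' (Measurable.aestronglyMeasurable ?_) ?_
  · exact (((measurable_truncate measurable_fst measurable_snd t).const_inner).const_mul _).exp.sub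
      (measurable_clip.comp (by fun_prop)).const_inner.exp
  · filter_upwards [Measure.quasiMeasurePreserving_snd.ae hτ0] with z hz
    exact abs_exp_inner_truncate_sub_le l z.1 ht hz

lemma integrable_exp_inner_truncate :
    Integrable (fun z : E d × ℝ => Real.exp (t⁻¹ * ⟪l, truncate t z.1 z.2⟫)) (ρ.prod τ) := by
  have hclip := (integrable_exp_inner_clip_smul (ρ := ρ) l t).comp_fst τ
  exact ((integrable_exp_inner_truncate_sub l ht hτ0 hτt).add hclip).congr
    (Eventually.of_forall fun _ => sub_add_cancel _ _)

lemma abs_integral_exp_inner_truncate_sub_le :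
    |(∫ z, Real.exp (t⁻¹ * ⟪l, truncate t z.1 z.2⟫) ∂(ρ.prod τ)) -
      ∫ x, Real.exp ⟪l, clip (t⁻¹ • x)⟫ ∂ρ| ≤
      Real.exp ‖l‖ * (mgf id τ (‖l‖ / t) - 1) * ρ.real {x | t < ‖x‖} := by
  have hclip := (integrable_exp_inner_clip_smul (ρ := ρ) l t).comp_fst τ
  calc |(∫ z, Real.exp (t⁻¹ * ⟪l, truncate t z.1 z.2⟫) ∂(ρ.prod τ)) -
        ∫ x, Real.exp ⟪l, clip (t⁻¹ • x)⟫ ∂ρ|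
      = |∫ z, (Real.exp (t⁻¹ * ⟪l, truncate t z.1 z.2⟫) - Real.exp ⟪l, clip (t⁻¹ • z.1)⟫)
          ∂(ρ.prod τ)| := by
        rw [integral_sub (integrable_exp_inner_truncate (ρ := ρ) l ht hτ0 hτt) hclip,
          integral_fun_fst (μ := ρ) (ν := τ) (fun x => Real.exp ⟪l, clip (t⁻¹ • x)⟫)]
        simp
    _ ≤ ∫ z, {x | t < ‖x‖}.indicator (fun _ => Real.exp ‖l‖) z.1 *
          (Real.exp (‖l‖ / t * z.2) - 1) ∂(ρ.prod τ) := by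
        rw [← Real.norm_eq_abs]
        refine norm_integral_le_of_norm_le (integrable_overshoot_bound l hτt) ?_
        filter_upwards [Measure.quasiMeasurePreserving_snd.ae hτ0] with z hz
        exact abs_exp_inner_truncate_sub_le l z.1 ht hz
    _ = (∫ x, {x | t < ‖x‖}.indicator (fun _ => Real.exp ‖l‖) x ∂ρ) *
          ∫ ℓ, (Real.exp (‖l‖ / t * ℓ) - 1) ∂τ :=
        integral_prod_mul (μ := ρ) (ν := τ) ({x : E d | t < ‖x‖}.indicator fun _ => Real.exp ‖l‖)
          fun ℓ => Real.exp (‖l‖ / t * ℓ) - 1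
    _ = ρ.real {x | t < ‖x‖} * Real.exp ‖l‖ * (mgf id τ (‖l‖ / t) - 1) := by
        rw [integral_indicator (measurableSet_lt_norm t), setIntegral_const, smul_eq_mul,
          integral_sub (f := fun ℓ => Real.exp (‖l‖ / t * ℓ)) hτt (integrable_const 1)]
        simp [mgf]
    _ = _ := by ring

omit ht hτt [IsFiniteMeasure ρ] in
/-- On the tail event, the overshoot changes the exponential by at most a multiple of
`exp (‖l‖ L / t) - 1`, whose mean tends to `0`. -/
theorem HasRegularTail.tendsto_integral_exp_truncate [IsProbabilityMeasure ρ] [SFinite μ]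
    (h : HasRegularTail ρ μ) (hα : IsTailIndex μ α) (hα2 : α < 2) (hρ : IsCentered ρ α)
    (hτ : 0 ∈ interior (integrableExpSet id τ)) :
    Tendsto (fun t => ((∫ z, Real.exp (t⁻¹ * ⟪l, truncate t z.1 z.2⟫) ∂(ρ.prod τ)) - 1) /
      ρ.real {x | t < ‖x‖}) atTop (𝓝 (Lam μ α l)) := by
  have hscale : Tendsto (fun t => ‖l‖ / t) atTop (𝓝 0) := tendsto_id.const_div_atTop _
  have hmgf : Tendsto (fun t => mgf id τ (‖l‖ / t)) atTop (𝓝 1) := by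
    simpa [Function.comp_def] using (differentiableAt_mgf hτ).continuousAt.tendsto.comp hscale
  have hovershoot : Tendsto (fun t => ((∫ z, Real.exp (t⁻¹ * ⟪l, truncate t z.1 z.2⟫)
      ∂(ρ.prod τ)) - ∫ x, Real.exp ⟪l, clip (t⁻¹ • x)⟫ ∂ρ) / ρ.real {x | t < ‖x‖}) atTop
      (𝓝 0) := by
    have hbound := (hmgf.sub_const 1).const_mul (Real.exp ‖l‖)
    rw [sub_self, mul_zero] at hbound
    refine squeeze_zero_norm' ?_ hbound
    filter_upwards [eventually_gt_atTop 0, hscale.eventually_mem (mem_interior_iff_mem_nhds.1 hτ)]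
      with t ht hτt
    rw [norm_div, Real.norm_of_nonneg measureReal_nonneg, div_le_iff₀ (h.tail_pos t)]
    exact abs_integral_exp_inner_truncate_sub_le l ht hτ0 hτt
  have hsum := hovershoot.add (h.tendsto_integral_exp_clip hα hρ hα2 l)
  rw [zero_add] at hsum
  refine hsum.congr fun t => ?_
  rw [integral_sub (integrable_exp_inner_clip_smul l t) (integrable_const 1), ← add_div]
  simp

end ExponentialMoment

/-! ### Row sums -/

section Independence

variable {Ω β γ ι : Type*} [MeasurableSpace Ω] [MeasurableSpace β] [MeasurableSpace γ]
  {P : Measure Ω} {X : ι → Ω → β} {Y : ι → Ω → γ}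

lemma measure_biInter_preimage_prod (hX : iIndepFun X P) (hY : iIndepFun Y P)
    (hXY : IndepFun (fun ω j => X j ω) (fun ω j => Y j ω) P) (S : Finset ι) {A : ι → Set β}
    {B : ι → Set γ} (hA : ∀ j ∈ S, MeasurableSet (A j)) (hB : ∀ j ∈ S, MeasurableSet (B j)) :
    P (⋂ j ∈ S, (fun ω => (X j ω, Y j ω)) ⁻¹' (A j ×ˢ B j)) =
      ∏ j ∈ S, P ((fun ω => (X j ω, Y j ω)) ⁻¹' (A j ×ˢ B j)) := by
  have hjoint : P ((⋂ j ∈ S, X j ⁻¹' A j) ∩ ⋂ j ∈ S, Y j ⁻¹' B j) =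
      P (⋂ j ∈ S, X j ⁻¹' A j) * P (⋂ j ∈ S, Y j ⁻¹' B j) := by
    have h := hXY.measure_inter_preimage_eq_mul
      (⋂ j ∈ S, (fun x => x j) ⁻¹' A j) (⋂ j ∈ S, (fun y => y j) ⁻¹' B j)
      (Finset.measurableSet_biInter S fun j hj => measurable_pi_apply j (hA j hj))
      (Finset.measurableSet_biInter S fun j hj => measurable_pi_apply j (hB j hj))
    simpa only [Set.preimage_iInter, ← Set.preimage_comp, Function.comp_def] using h
  have hpair : ∀ j ∈ S, P (X j ⁻¹' A j ∩ Y j ⁻¹' B j) = P (X j ⁻¹' A j) * P (Y j ⁻¹' B j) :=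
    fun j hj => (hXY.comp (measurable_pi_apply j) (measurable_pi_apply j)
      ).measure_inter_preimage_eq_mul _ _ (hA j hj) (hB j hj)
  simp only [Set.mk_preimage_prod, Set.iInter_inter_distrib]
  rw [hjoint, hX.measure_inter_preimage_eq_mul S hA, hY.measure_inter_preimage_eq_mul S hB,
    Finset.prod_congr rfl hpair, Finset.prod_mul_distrib]

lemma iIndepFun_prodMk_of_indepFun (hXm : ∀ j, Measurable (X j)) (hYm : ∀ j, Measurable (Y j))
    (hX : iIndepFun X P) (hY : iIndepFun Y P)
    (hXY : IndepFun (fun ω j => X j ω) (fun ω j => Y j ω) P) :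
    iIndepFun (fun j ω => (X j ω, Y j ω)) P := by
  rw [iIndepFun_iff_iIndep]
  refine iIndepSets.iIndep (fun j => ((hXm j).prodMk (hYm j)).comap_le)
    (fun j => Set.preimage (fun ω => (X j ω, Y j ω)) ''
      Set.image2 (· ×ˢ ·) {s | MeasurableSet s} {t | MeasurableSet t})
    (fun j => isPiSystem_prod.comap _)
    (fun j => by rw [← generateFrom_prod, MeasurableSpace.comap_generateFrom]) ?_
  rw [iIndepSets_iff]
  intro S f hf
  choose! R hR hRf using hf
  choose! A hA B hB hAB using hR
  have hf : ∀ j ∈ S, f j = (fun ω => (X j ω, Y j ω)) ⁻¹' (A j ×ˢ B j) := fun j hj => by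
    rw [← hRf j hj, ← hAB j hj]
  rw [Set.iInter₂_congr hf, Finset.prod_congr rfl fun j hj => congrArg P (hf j hj)]
  exact measure_biInter_preimage_prod hX hY hXY S hA hB

end Independence

section IdenticallyDistributed

variable {Ω Ω' : Type*} [MeasurableSpace Ω] [MeasurableSpace Ω'] {P : Measure Ω} {m : Measure Ω'}
  {Y : ℕ → Ω → Ω'} {g : Ω' → ℝ} {t : ℝ}

lemma integrable_exp_mul_sum_comp [IsFiniteMeasure P] (hYm : ∀ j, Measurable (Y j))
    (hY : iIndepFun Y P) (hlaw : ∀ j, P.map (Y j) = m) (hg : Measurable g)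
    (hint : t ∈ integrableExpSet g m) (n : ℕ) :
    Integrable (fun ω => Real.exp (t * ∑ j ∈ Finset.range n, g (Y j ω))) P := by
  have hsummand (j : ℕ) : Integrable (fun ω => Real.exp (t * g (Y j ω))) P := by
    rw [← hlaw j] at hint
    exact hint.comp_measurable (hYm j)
  simpa using (hY.comp _ fun _ => hg).integrable_exp_mul_sum (s := Finset.range n)
    (fun j => hg.comp (hYm j)) fun j _ => hsummand j

lemma cgf_sum_comp (hYm : ∀ j, Measurable (Y j)) (hY : iIndepFun Y P)
    (hlaw : ∀ j, P.map (Y j) = m) (hg : Measurable g) (hint : t ∈ integrableExpSet g m) (n : ℕ) :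
    cgf (fun ω => ∑ j ∈ Finset.range n, g (Y j ω)) P t = n * cgf g m t := by
  have hident (j : ℕ) : IdentDistrib (g ∘ Y j) g P m :=
    ⟨(hg.comp (hYm j)).aemeasurable, hg.aemeasurable, by rw [← Measure.map_map hg (hYm j), hlaw]⟩
  have hsummand (j : ℕ) : Integrable (fun ω => Real.exp (t * (g ∘ Y j) ω)) P :=
    ((hident j).comp (u := fun x => Real.exp (t * x)) (by fun_prop)).integrable_iff.2 hint
  have hcgf (j : ℕ) : cgf (g ∘ Y j) P t = cgf g m t := by
    rw [cgf, cgf, mgf_congr_of_identDistrib _ _ (hident j)]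
  have hsum := (hY.comp _ fun _ => hg).cgf_sum (s := Finset.range n)
    (fun j => hg.comp (hYm j)) fun j _ => hsummand j
  simpa [hcgf, Finset.sum_fn] using hsum

end IdenticallyDistributed

lemma tendsto_log_div_of_tendsto_sub_one_div {ι : Type*} {u : Filter ι} {W G : ι → ℝ} {c : ℝ}
    (hG : Tendsto G u (𝓝 0)) (hG0 : ∀ i, 0 < G i)
    (hW : Tendsto (fun i => (W i - 1) / G i) u (𝓝 c)) :
    Tendsto (fun i => Real.log (W i) / G i) u (𝓝 c) := by
  have hW1 : Tendsto W u (𝓝 1) := by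
    have h := (hW.mul hG).add_const 1
    rw [mul_zero, zero_add] at h
    exact h.congr fun i => by rw [div_mul_cancel₀ _ (hG0 i).ne', sub_add_cancel]
  have hlower := hW.div hW1 one_ne_zero
  rw [div_one] at hlower
  have hWpos : ∀ᶠ i in u, 0 < W i := hW1.eventually_const_lt one_pos
  refine tendsto_of_tendsto_of_tendsto_of_le_of_le' hlower hW ?_ ?_
  · filter_upwards [hWpos] with i hi
    calc (W i - 1) / G i / W i = (1 - (W i)⁻¹) / G i := by field_simp
      _ ≤ Real.log (W i) / G i :=
        div_le_div_of_nonneg_right (Real.one_sub_inv_le_log_of_pos hi) (hG0 i).le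
  · filter_upwards [hWpos] with i hi
    exact div_le_div_of_nonneg_right (Real.log_le_sub_one_of_pos hi) (hG0 i).le

lemma tendsto_measureReal_lt_norm {d : ℕ} (ρ : Measure (E d)) [IsFiniteMeasure ρ] :
    Tendsto (fun t => ρ.real {x | t < ‖x‖}) atTop (𝓝 0) := by
  have h := tendsto_measure_norm_gt_of_isTightMeasureSet (isTightMeasureSet_singleton (μ := ρ))
  simp only [Set.mem_singleton_iff, iSup_iSup_eq_left] at h
  exact (ENNReal.tendsto_toReal ENNReal.zero_ne_top).comp h

lemma zero_mem_interior_integrableExpSet {Ω : Type*} [MeasurableSpace Ω] {P : Measure Ω}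
    [IsFiniteMeasure P] {X : Ω → ℝ} (hX : AEMeasurable X P) (hX0 : ∀ᵐ ω ∂P, 0 ≤ X ω) {ε : ℝ}
    (hε : 0 < ε) (hint : ε ∈ integrableExpSet X P) : 0 ∈ interior (integrableExpSet X P) := by
  refine mem_interior_iff_mem_nhds.2 (mem_of_superset (Iio_mem_nhds hε) fun s hs => ?_)
  refine Integrable.mono' hint (hX.const_mul s).exp.aestronglyMeasurable ?_
  filter_upwards [hX0] with ω hω
  rw [Real.norm_eq_abs, Real.abs_exp]
  gcongr
  exact hs.le

section RowSum

variable {Ω : Type*} [MeasurableSpace Ω] {P : Measure Ω} {d : ℕ} {ρ μ : Measure (E d)}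
  {τ : Measure ℝ} {α : ℝ} {M : ℕ → ℝ} {Hs : ℕ → Ω → E d} {Ls : ℕ → Ω → ℝ}

lemma measurable_rowSum (hHs : ∀ j, Measurable (Hs j)) (hLs : ∀ j, Measurable (Ls j)) (n : ℕ) :
    Measurable (rowSum M Hs Ls n) :=
  Finset.measurable_fun_sum _ fun j _ => measurable_truncate (hHs j) (hLs j) (M n)

omit [MeasurableSpace Ω] in
lemma mul_inner_smul_rowSum (l : E d) {n : ℕ} (hn : 0 < n) {q : ℝ} (hq : q ≠ 0) (ω : Ω) :
    n * q * ⟪l, ((n : ℝ) * M n * q)⁻¹ • rowSum M Hs Ls n ω⟫ =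
      (M n)⁻¹ * ∑ j ∈ Finset.range n, ⟪l, truncate (M n) (Hs j ω) (Ls j ω)⟫ := by
  rw [real_inner_smul_right, rowSum, inner_sum, ← mul_assoc]
  congr 1
  field_simp

theorem hasScaledCGF_rowSum [IsProbabilityMeasure P] [IsProbabilityMeasure ρ]
    [IsProbabilityMeasure τ] [SFinite μ] (hHs : ∀ j, Measurable (Hs j))
    (hLs : ∀ j, Measurable (Ls j)) (hindep : iIndepFun (fun j ω => (Hs j ω, Ls j ω)) P)
    (hlaw : ∀ j, P.map (fun ω => (Hs j ω, Ls j ω)) = ρ.prod τ) (h : HasRegularTail ρ μ)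
    (hα : IsTailIndex μ α) (hα2 : α < 2) (hρ : IsCentered ρ α) (hτ0 : ∀ᵐ ℓ ∂τ, 0 ≤ ℓ)
    (hτ : 0 ∈ interior (integrableExpSet id τ)) (hM : Tendsto M atTop atTop)
    (hhard : Tendsto (fun n : ℕ => n * ρ.real {x | M n < ‖x‖}) atTop atTop) :
    HasScaledCGF (fun n => P.map fun ω =>
        ((n : ℝ) * M n * ρ.real {x | M n < ‖x‖})⁻¹ • rowSum M Hs Ls n ω)
      (fun n => n * ρ.real {x | M n < ‖x‖}) (Lam μ α) := by
  have htrunc (l : E d) (t : ℝ) : Measurable fun z : E d × ℝ => ⟪l, truncate t z.1 z.2⟫ :=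
    (measurable_truncate measurable_fst measurable_snd t).const_inner
  have hpair (j : ℕ) : Measurable fun ω => (Hs j ω, Ls j ω) := (hHs j).prodMk (hLs j)
  have hZ (n : ℕ) : Measurable fun ω =>
      ((n : ℝ) * M n * ρ.real {x | M n < ‖x‖})⁻¹ • rowSum M Hs Ls n ω :=
    (measurable_rowSum hHs hLs n).fun_const_smul _
  have hint (l : E d) : ∀ᶠ n in atTop,
      (M n)⁻¹ ∈ integrableExpSet (fun z => ⟪l, truncate (M n) z.1 z.2⟫) (ρ.prod τ) := by
    filter_upwards [hM.eventually_gt_atTop 0,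
      (hM.const_div_atTop ‖l‖).eventually_mem (mem_interior_iff_mem_nhds.1 hτ)] with n hn hnτ
    exact integrable_exp_inner_truncate l hn hτ0 hnτ
  refine ⟨hhard, fun l => ?_, fun l => ?_⟩
  · filter_upwards [hint l, eventually_gt_atTop 0] with n hnint hn
    rw [integrable_map_measure (by fun_prop) (hZ n).aemeasurable]
    simp only [Function.comp_def, mul_inner_smul_rowSum l hn (h.tail_pos (M n)).ne']
    exact integrable_exp_mul_sum_comp hpair hindep hlaw (htrunc l (M n)) hnint n
  · have hlog := tendsto_log_div_of_tendsto_sub_one_div ((tendsto_measureReal_lt_norm ρ).comp hM)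
      (fun n => h.tail_pos (M n))
      ((h.tendsto_integral_exp_truncate l hτ0 hα hα2 hρ hτ).comp hM)
    refine hlog.congr' ?_
    filter_upwards [hint l, eventually_gt_atTop 0] with n hnint hn
    have hcgf := cgf_sum_comp hpair hindep hlaw (htrunc l (M n)) hnint n
    simp only [cgf, mgf] at hcgf ⊢
    rw [integral_map (hZ n).aemeasurable (by fun_prop)]
    simp only [mul_inner_smul_rowSum l hn (h.tail_pos (M n)).ne', hcgf, Function.comp_apply]
    field_simp

lemma isCentered_map {H : Ω → E d} (hH : Measurable H)
    (hsymm : α = 1 → IdentDistrib H (fun ω => -H ω) P P)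
    (hmean : 1 < α → Integrable H P ∧ ∫ ω, H ω ∂P = 0) : IsCentered (P.map H) α where
  map_neg h1 := by
    rw [Measure.map_map measurable_neg hH]
    exact (hsymm h1).map_eq.symm
  integrable h1 := (integrable_map_measure aestronglyMeasurable_id hH.aemeasurable).2 (hmean h1).1
  integral_eq_zero h1 := (integral_map hH.aemeasurable aestronglyMeasurable_id).trans (hmean h1).2

end RowSum

end TruncatedTails

theorem theorem3p1 {Ω : Type*} [MeasurableSpace Ω] (P : Measure Ω) [IsProbabilityMeasure P]
    {d : ℕ}
    -- the generic heavy-tailed vector `H`, with its limit measure and its tail index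
    (H : Ω → TruncatedTails.E d) (hH : Measurable H)
    (a : ℕ → ℝ) (μ : Measure (TruncatedTails.E d)) (α : ℝ)
    (htail : TruncatedTails.HasPowerLawTail P H a μ)
    (hindex : TruncatedTails.IsTailIndex μ α) (hα : α < 2)
    (hsymm : α = 1 → IdentDistrib H (fun ω => -H ω) P P)
    (hmean : 1 < α → Integrable H P ∧ ∫ ω, H ω ∂P = 0)
    -- the generic nonnegative variable `L`, with an exponential moment
    (L : Ω → ℝ) (hL : Measurable L) (hLnonneg : ∀ᵐ ω ∂P, 0 ≤ L ω)
    (hLexp : ∃ ε : ℝ, 0 < ε ∧ Integrable (fun ω => Real.exp (ε * L ω)) P)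
    -- the i.i.d. copies of `H` and of `L`, the two families being independent
    (Hs : ℕ → Ω → TruncatedTails.E d) (hHs : ∀ j, Measurable (Hs j))
    (hHsindep : iIndepFun Hs P) (hHsid : ∀ j, IdentDistrib (Hs j) H P P)
    (Ls : ℕ → Ω → ℝ) (hLs : ∀ j, Measurable (Ls j))
    (hLsindep : iIndepFun Ls P) (hLsid : ∀ j, IdentDistrib (Ls j) L P P)
    (hindep : IndepFun (fun ω j => Hs j ω) (fun ω j => Ls j ω) P)
    -- the truncation levels, in the hard truncation regime
    (M : ℕ → ℝ) (hM : Tendsto M atTop atTop)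
    (hhard : Tendsto (fun n : ℕ => (n : ℝ) * P.real {ω | M n < ‖H ω‖}) atTop atTop) :
    -- the integrals in the definition of `Λ` converge absolutely
    (∀ l : TruncatedTails.E d,
      Integrable (TruncatedTails.integrand α l) (TruncatedTails.nu μ) ∧
      Integrable (fun s => (inner ℝ l s : ℝ)) (TruncatedTails.spectral μ)) ∧
    TruncatedTails.IsLDP P
      (fun n ω => ((n : ℝ) * M n * P.real {ω' | M n < ‖H ω'‖})⁻¹ •
        TruncatedTails.rowSum M Hs Ls n ω)
      (fun n : ℕ => (n : ℝ) * P.real {ω | M n < ‖H ω‖})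
      (TruncatedTails.fenchelLegendre (TruncatedTails.Lam μ α)) := by
  have hsigma := htail.sigmaFinite
  have hregular := htail.hasRegularTail hH hindex
  have := Measure.isProbabilityMeasure_map (μ := P) hH.aemeasurable
  have := Measure.isProbabilityMeasure_map (μ := P) hL.aemeasurable
  refine ⟨fun l => ⟨hregular.integrable_integrand hindex hα l,
    hregular.integrable_spectral hindex (by fun_prop)⟩, ?_⟩
  have hpairs := TruncatedTails.iIndepFun_prodMk_of_indepFun hHs hLs hHsindep hLsindep hindep
  have hlaw : ∀ j, P.map (fun ω => (Hs j ω, Ls j ω)) = (P.map H).prod (P.map L) := fun j => by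
    rw [← (hHsid j).map_eq, ← (hLsid j).map_eq]
    exact (indepFun_iff_map_prod_eq_prod_map_map (hHs j).aemeasurable (hLs j).aemeasurable).1
      (hindep.comp (measurable_pi_apply j) (measurable_pi_apply j))
  have hL0 : ∀ᵐ ℓ ∂(P.map L), 0 ≤ ℓ := (ae_map_iff hL.aemeasurable measurableSet_Ici).2 hLnonneg
  obtain ⟨ε, hε, hint⟩ := hLexp
  have hexp := TruncatedTails.zero_mem_interior_integrableExpSet aemeasurable_id hL0 hε
    ((integrable_map_measure (by fun_prop) hL.aemeasurable).2 hint)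
  have hmeas : ∀ t, P.real {ω | t < ‖H ω‖} = (P.map H).real {x | t < ‖x‖} := fun t =>
    (map_measureReal_apply hH (TruncatedTails.measurableSet_lt_norm t)).symm
  simp only [hmeas] at hhard ⊢
  exact TruncatedTails.isLDP_of_hasScaledCGF
    (fun n => (TruncatedTails.measurable_rowSum hHs hLs n).fun_const_smul _)
    (TruncatedTails.hasScaledCGF_rowSum hHs hLs hpairs hlaw hregular hindex hα
      (TruncatedTails.isCentered_map hH hsymm hmean) hL0 hexp hM hhard)
    (hregular.differentiable_Lam hindex hα)
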